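/- Let $(Z,\mathcal Z,\mu)$ be a $\sigma$-finite measure space (for instance a Borel space with a $\sigma$-finite non-atomic Borel measure). Let $N$ be a Poisson random measure on $Z$ with control $\mu$, defined on a probability space $(\Omega,\mathcal F,\mathbb P)$: a random measure such that $N(B)$ has the Poisson law with parameter $\mu(B)$ whenever $\mu(B)<\infty$, and the masses of finitely many pairwise disjoint sets of finite $\mu$-measure are independent. Let $\hat N(B)=N(B)-\mu(B)$ for $\mu(B)<\infty$, and for $h\in L^2(\mu)$ let $\hat N(h)=\int_Z h\,d\hat N$ be the Wiener–Itô integral, i.e. the $L^2(\mathbb P)$-limit of the integrals $\hat N(s_k)=\sum_{c\neq 0} c\,\hat N(\{s_k=c\})$ of simple functions $s_k$ with support of finite measure converging to $h$ in $L^2(\mu)$. For a $d\times d$ real matrix $A$ let $\|A\|_{op}$ be the operator norm for the Euclidean norm and $\|A\|_{H.S.}=\sqrt{\operatorname{Tr}(AA^T)}$. For $\mathbb R^d$-valued random vectors $X,Y$ with $\mathbb E\|X\|,\mathbb E\|Y\|<\infty$ let $$d_2(X,Y)=\sup_g|\mathbb E[g(X)]-\mathbb E[g(Y)]|,$$ the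 supremum being over all $g\in C^2(\mathbb R^d)$ such that $g$ and $\nabla g$ are Lipschitz with constant at most $1$ for the Euclidean norm. Fix $d\ge 2$, let $C$ be a positive definite $d\times d$ matrix and $X\sim\mathcal N_d(0,C)$ a centered Gaussian vector with covariance matrix $C$. For each $n$ let $h_{n,1},\dots,h_{n,d}\in L^2(\mu)$, let $F_n=(\hat N(h_{n,1}),\dots,\hat N(h_{n,d}))$ and let $K_n$ be the covariance matrix of $F_n$. Then $K_n(i,j)=\mathbb E[\hat N(h_{n,i})\hat N(h_{n,j})]=\int_Z h_{n,i}h_{n,j}\,d\mu$ for all $i,j$, and for every $n$ $$ d_2(F_n,X) \le \|C^{-1}\|_{op}\,\|C\|_{op}^{1/2}\,\|C-K_n\|_{H.S.} + \frac{d^2\sqrt{2\pi}}{8}\,\|C^{-1}\|_{op}^{3/2}\,\|C\|_{op}\sum_{i=1}^d\int_Z |h_{n,i}(z)|^3\,\mu(dz), $$ where the right-hand side may be $+\infty$. In particular, if, as $n\to\infty$, $$K_n(i,j)\to C(i,j)\quad\text{and}\quad \int_Z |h_{n,i}(z)|^3\,\mu(dz)\to 0\qquad\text{for all } i,j=1,\dots,d,$$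 then $d_2(F_n,X)\to 0$ and $F_n$ converges in distribution to $X$. -/

import Mathlib

open MeasureTheory ProbabilityTheory Filter Topology
open scoped ENNReal NNReal

noncomputable section

namespace PoissonChaos

/-- `N` is a Poisson random measure on `Z` with control (intensity) `μ`, defined on the probability
space `(Ω, P)`: a random measure such that `N(B)` is Poisson distributed with parameter `μ(B)` for
each measurable `B` with `μ(B) < ∞`, and such that the masses of finitely many pairwise disjoint
sets of this kind are independent. -/
structure IsPoissonRandomMeasure {Ω Z : Type*} [MeasurableSpace Ω] [MeasurableSpace Z]
    (N : Ω → Measure Z) (μ : Measure Z) (P : Measure Ω) : Prop where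
  measurable : Measurable N
  hasLaw : ∀ B : Set Z, MeasurableSet B → μ B < ∞ →
    HasLaw (fun ω => N ω B)
      ((poissonMeasure (μ B).toNNReal).map (fun n : ℕ => (n : ℝ≥0∞))) P
  indep : ∀ (k : ℕ) (B : Fin k → Set Z), (∀ i, MeasurableSet (B i)) → (∀ i, μ (B i) < ∞) →
    Pairwise (fun i j => Disjoint (B i) (B j)) → iIndepFun (fun i ω => N ω (B i)) P

/-- The compensated Poisson measure `N̂(B) = N(B) - μ(B)` (used for `μ(B) < ∞`). -/
def compensated {Ω Z : Type*} [MeasurableSpace Z] (N : Ω → Measure Z) (μ : Measure Z)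
    (B : Set Z) (ω : Ω) : ℝ :=
  (N ω).real B - μ.real B

/-- The integral `N̂(s) = ∑ c, c * N̂(s = c)` of a simple function; the value `c = 0` contributes
nothing. Used for simple functions whose support has finite measure. -/
def simpleIntegral {Ω Z : Type*} [MeasurableSpace Z] (N : Ω → Measure Z) (μ : Measure Z)
    (s : SimpleFunc Z ℝ) (ω : Ω) : ℝ :=
  ∑ c ∈ s.range, c * compensated N μ (s ⁻¹' {c}) ω

/-- `F` is a version of the Wiener-Itô integral `N̂(h) = ∫ h dN̂`: it is the limit in `L²(P)` of the
integrals of simple functions with support of finite measure which converge to `h` in `L²(μ)`. -/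
def IsWienerIto {Ω Z : Type*} [MeasurableSpace Ω] [MeasurableSpace Z]
    (N : Ω → Measure Z) (μ : Measure Z) (P : Measure Ω) (h : Z → ℝ) (F : Ω → ℝ) : Prop :=
  MemLp F 2 P ∧ ∃ s : ℕ → SimpleFunc Z ℝ, (∀ k, (s k).FinMeasSupp μ) ∧
    Tendsto (fun k => eLpNorm (fun z => s k z - h z) 2 μ) atTop (𝓝 0) ∧
    Tendsto (fun k => eLpNorm (fun ω => simpleIntegral N μ (s k) ω - F ω) 2 P) atTop (𝓝 0)

open Classical in
/-- The Wiener-Itô integral `N̂(h)` of `h ∈ L²(μ)`: a version of it, which is unique up to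
`P`-null sets (and `0` if there were none). -/
def wienerIto {Ω Z : Type*} [MeasurableSpace Ω] [MeasurableSpace Z]
    (N : Ω → Measure Z) (μ : Measure Z) (P : Measure Ω) (h : Z → ℝ) : Ω → ℝ :=
  if H : ∃ F : Ω → ℝ, IsWienerIto N μ P h F then H.choose else 0

/-- The random vector `(N̂(h₁), …, N̂(h_d))` in the first Wiener chaos. -/
def chaosVector {Ω Z : Type*} [MeasurableSpace Ω] [MeasurableSpace Z] {d : ℕ}
    (N : Ω → Measure Z) (μ : Measure Z) (P : Measure Ω) (h : Fin d → Z → ℝ) (ω : Ω) :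
    EuclideanSpace ℝ (Fin d) :=
  WithLp.toLp 2 (fun i => wienerIto N μ P (h i) ω)

/-- The covariance matrix of a random vector. -/
def covMatrix {Ω : Type*} [MeasurableSpace Ω] {d : ℕ} (F : Ω → EuclideanSpace ℝ (Fin d))
    (P : Measure Ω) : Matrix (Fin d) (Fin d) ℝ :=
  Matrix.of fun i j => cov[fun ω => F ω i, fun ω => F ω j; P]

/-- The operator norm of a square matrix with respect to the Euclidean norm. -/
def opNorm {d : ℕ} (A : Matrix (Fin d) (Fin d) ℝ) : ℝ :=
  ‖Matrix.toEuclideanCLM (n := Fin d) (𝕜 := ℝ) A‖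

/-- The Hilbert-Schmidt norm of a square matrix. -/
def hsNorm {d : ℕ} (A : Matrix (Fin d) (Fin d) ℝ) : ℝ :=
  √(Matrix.trace (A * A.transpose))

/-- The test functions `g ∈ C²(ℝᵈ)` with `‖g‖_Lip ≤ 1` and `M₂(g) ≤ 1`, where `M₂(g)` is the
Lipschitz constant of the gradient. -/
def testFunctions (d : ℕ) : Set (EuclideanSpace ℝ (Fin d) → ℝ) :=
  {g | ContDiff ℝ 2 g ∧ LipschitzWith 1 g ∧ LipschitzWith 1 (gradient g)}

/-- The distance `d₂` between two laws on `ℝᵈ` with finite first moments. -/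
def d2 {d : ℕ} (ν₁ ν₂ : Measure (EuclideanSpace ℝ (Fin d))) : ℝ≥0∞ :=
  ⨆ g ∈ testFunctions d, ENNReal.ofReal |∫ x, g x ∂ν₁ - ∫ x, g x ∂ν₂|

end PoissonChaos

end

/-!
Write `F = N̂(h)` for the vector of Wiener-Itô integrals, `K` for its covariance matrix and `X` for
the Gaussian vector. The proof interpolates between `F` and `X`, taken independent of each other,
and trades derivatives of the test function `g`, of which only two are available, for the Gaussian
score `⟪C⁻¹ X, ·⟫`.

*Simple kernels.* If the kernels are simple functions, `F = ∑ₖ (nₖ - λₖ) cₖ` with independent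
Poisson counts `nₖ` of intensity `λₖ`, one for each nonzero value `cₖ ∈ ℝᵈ` of the vector of kernels
(`map_vectorIntegral`). Let `H θ = E[g(sin θ F + cos θ X)]`, so that `H (π/2) = E[g(F)]` and
`H 0 = E[g(X)]`. The derivative `H' θ = E⟪cos θ F - sin θ X, ∇g(sin θ F + cos θ X)⟫` is transformed
by integration by parts, in its Poisson form for `F` (`integral_inner_compSum_mix`, from the Mecke
formula `withDensity_poissonPi`) and in its Gaussian form for `X` (`integral_inner_mul_jointLaw`).
Two terms remain. The pairing of `K - C` with the mean Hessian of `g` is bounded by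
`‖C⁻¹‖^{1/2} ‖C - K‖_HS`, because the Hessian can be replaced by the gradient times the score, and
the gradient is bounded by `1` (`abs_mul_sum_meanJacobian_le`). The second-order Taylor remainder of
`∇g` along a jump `sin θ cₖ` would involve third derivatives of `g`; one of them is again absorbed
by the score, and what is left is the increment of the `1`-Lipschitz function `∇g`
(`abs_taylor_remainder_le`). Together
`|H' θ| ≤ sin θ ‖C⁻¹‖^{1/2} (‖C - K‖_HS + ½ ∑ₖ λₖ |cₖ|³)` (`abs_integral_speed_le`), and
integration over `[0, π/2]` gives `abs_integral_compSum_sub_gaussian_le`.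

*General kernels.* The isometry on simple functions, itself a consequence of the Mecke formula, and
the completeness of `L²` give existence (`exists_isWienerIto`) and independence of the approximating
sequence (`IsWienerIto.tendsto`) of the Wiener-Itô integral. When the kernels lie in `L³`, simple
functions converging to them in `L²` and in `L³` at once (`exists_simpleFunc_tendsto`) carry the
estimate over (`abs_integral_chaosVector_sub_le`); otherwise the asserted bound is infinite. The
constants obtained in this way are at most the asserted ones: `1 ≤ ‖C⁻¹‖ ‖C‖`,
`|v|³ ≤ √d ∑ᵢ |vᵢ|³`, and `½ √d ≤ d² √(2π) / 8` for `d ≥ 2` (`half_mul_sqrt_mul_sqrt_le`).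

*Convergence in distribution.* The functions `cos ⟪x, t⟫` and `sin ⟪x, t⟫` are multiples of test
functions of `d₂`, so that convergence in `d₂` forces convergence of characteristic functions, and
Lévy's continuity theorem applies (`tendsto_of_tendsto_d2`).
-/

namespace PoissonChaos

open scoped RealInnerProductSpace

/-! ### Gaussian integration by parts -/

lemma integrable_gaussianReal_iff {f : ℝ → ℝ} :
    Integrable f (gaussianReal 0 1) ↔ Integrable (fun x => gaussianPDFReal 0 1 x * f x) := by
  rw [gaussianReal_of_var_ne_zero _ one_ne_zero,
    integrable_withDensity_iff_integrable_smul' (measurable_gaussianPDF _ _)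
      (ae_of_all _ fun _ => gaussianPDF_lt_top)]
  simp [toReal_gaussianPDF]

lemma hasDerivAt_gaussianPDFReal (x : ℝ) :
    HasDerivAt (gaussianPDFReal 0 1) (-(x * gaussianPDFReal 0 1 x)) x := by
  have h : HasDerivAt (fun y : ℝ => (√(2 * Real.pi))⁻¹ * Real.exp (-y ^ 2 / 2))
      ((√(2 * Real.pi))⁻¹ * (Real.exp (-x ^ 2 / 2) * (-(2 * x) / 2))) x := by
    refine ((((hasDerivAt_pow 2 x).neg.div_const 2).exp).const_mul _).congr_deriv ?_
    simp
  have e : gaussianPDFReal 0 1 = fun y : ℝ => (√(2 * Real.pi))⁻¹ * Real.exp (-y ^ 2 / 2) := by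
    ext y; simp [gaussianPDFReal_def]
  rw [e]
  exact h.congr_deriv (by ring)

/-- One-dimensional Gaussian integration by parts. -/
lemma integral_mul_gaussianReal {f f' : ℝ → ℝ} (hf : ∀ x, HasDerivAt f (f' x) x)
    (h0 : Integrable f (gaussianReal 0 1)) (h1 : Integrable (fun x => x * f x) (gaussianReal 0 1))
    (h2 : Integrable f' (gaussianReal 0 1)) :
    ∫ x, x * f x ∂(gaussianReal 0 1) = ∫ x, f' x ∂(gaussianReal 0 1) := by
  rw [integrable_gaussianReal_iff] at h0 h1 h2
  rw [integral_gaussianReal_eq_integral_smul one_ne_zero,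
    integral_gaussianReal_eq_integral_smul one_ne_zero]
  have h := integral_mul_deriv_eq_deriv_mul_of_integrable (u := gaussianPDFReal 0 1) (v := f)
    (fun x _ => hasDerivAt_gaussianPDFReal x) (fun x _ => hf x) h2
    (h1.neg.congr (ae_of_all _ fun x => by simp; ring)) h0
  simp only [smul_eq_mul]
  rw [h, ← integral_neg]
  exact integral_congr_ae (ae_of_all _ fun x => by ring)

/-- Resampling one coordinate leaves a product of probability measures unchanged. -/
lemma measurePreserving_update {ι : Type*} [Fintype ι] [DecidableEq ι] {X : ι → Type*}
    [∀ i, MeasurableSpace (X i)] (ν : ∀ i, Measure (X i)) [∀ i, IsProbabilityMeasure (ν i)]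
    (i : ι) :
    MeasurePreserving (fun p : (∀ j, X j) × X i => Function.update p.1 i p.2)
      ((Measure.pi ν).prod (ν i)) (Measure.pi ν) := by
  have hm : Measurable (fun p : (∀ j, X j) × X i => Function.update p.1 i p.2) := by
    refine measurable_pi_lambda _ fun j => ?_
    by_cases h : j = i
    · subst h; simpa using measurable_snd
    · simp only [Function.update_of_ne h]
      exact (measurable_pi_apply j).comp measurable_fst
  refine ⟨hm, (Measure.pi_eq fun s hs => ?_).symm⟩
  have e : (fun p : (∀ j, X j) × X i => Function.update p.1 i p.2) ⁻¹' (Set.univ.pi s)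
      = (Set.univ.pi (Function.update s i Set.univ)) ×ˢ (s i) := by
    ext ⟨x, y⟩
    simp only [Set.mem_preimage, Set.mem_pi, Set.mem_univ, true_imp_iff, Set.mem_prod]
    constructor
    · intro h
      refine ⟨fun j => ?_, by simpa using h i⟩
      by_cases hj : j = i
      · subst hj; simp
      · simpa [Function.update_of_ne hj] using h j
    · rintro ⟨h, h'⟩ j
      by_cases hj : j = i
      · subst hj; simpa using h'
      · simpa [Function.update_of_ne hj] using h j
  rw [Measure.map_apply hm (MeasurableSet.univ_pi hs), e, Measure.prod_prod, Measure.pi_pi,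
    ← Finset.prod_erase_mul _ _ (Finset.mem_univ i),
    ← Finset.prod_erase_mul _ (fun i => ν i (s i)) (Finset.mem_univ i)]
  simp only [Function.update_self, measure_univ, mul_one]
  congr 1
  refine Finset.prod_congr rfl fun j hj => ?_
  rw [Function.update_of_ne (Finset.ne_of_mem_erase hj)]

lemma integral_eval_mul_pi_gaussianReal {ι : Type*} [Fintype ι] [DecidableEq ι] (i : ι)
    {ψ ψ' : (ι → ℝ) → ℝ}
    (hψ : ∀ x t, HasDerivAt (fun r => ψ (Function.update x i r)) (ψ' (Function.update x i t)) t)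
    (h0 : Integrable ψ (Measure.pi fun _ => gaussianReal 0 1))
    (h1 : Integrable (fun x => x i * ψ x) (Measure.pi fun _ => gaussianReal 0 1))
    (h2 : Integrable ψ' (Measure.pi fun _ => gaussianReal 0 1)) :
    ∫ x, x i * ψ x ∂(Measure.pi fun _ => gaussianReal 0 1)
      = ∫ x, ψ' x ∂(Measure.pi fun _ => gaussianReal 0 1) := by
  have mp := measurePreserving_update (fun _ : ι => gaussianReal 0 1) i
  have key : ∀ f : (ι → ℝ) → ℝ, Integrable f (Measure.pi fun _ => gaussianReal 0 1) →
      ∫ x, f x ∂(Measure.pi fun _ => gaussianReal 0 1)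
        = ∫ x, ∫ t, f (Function.update x i t) ∂(gaussianReal 0 1)
            ∂(Measure.pi fun _ => gaussianReal 0 1) := by
    intro f hf
    rw [← integral_prod (f := fun p : (ι → ℝ) × ℝ => f (Function.update p.1 i p.2))
      ((mp.integrable_comp hf.1).2 hf)]
    conv_lhs => rw [← mp.map_eq]
    rw [integral_map mp.measurable.aemeasurable (by rw [mp.map_eq]; exact hf.1)]
  rw [key _ h1, key _ h2]
  refine integral_congr_ae ?_
  filter_upwards [((mp.integrable_comp h0.1).2 h0).prod_right_ae,
    ((mp.integrable_comp h1.1).2 h1).prod_right_ae,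
    ((mp.integrable_comp h2.1).2 h2).prod_right_ae] with x a0 a1 a2
  simp only [Function.comp_def, Function.update_self] at a0 a1 a2 ⊢
  exact integral_mul_gaussianReal (hψ x) a0 a1 a2

lemma norm_le_of_lipschitzWith {E F : Type*} [NormedAddCommGroup E] [NormedAddCommGroup F]
    {φ : E → F} {K : ℝ≥0} (hφ : LipschitzWith K φ) (x : E) : ‖φ x‖ ≤ ‖φ 0‖ + K * ‖x‖ := by
  have h := hφ.norm_sub_le x 0
  rw [sub_zero] at h
  have h2 : ‖φ x‖ ≤ ‖φ x - φ 0‖ + ‖φ 0‖ := by simpa using norm_add_le (φ x - φ 0) (φ 0)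
  linarith

lemma memLp_lipschitz_comp {α E : Type*} [MeasurableSpace α] [NormedAddCommGroup E]
    {ν : Measure α} [IsFiniteMeasure ν] {φ : E → ℝ} {K : ℝ≥0} (hφ : LipschitzWith K φ)
    {p : ℝ≥0∞} {Y : α → E} (hY : MemLp Y p ν) : MemLp (fun a => φ (Y a)) p ν := by
  have hb : MemLp (fun a => ‖φ 0‖ + K * ‖Y a‖) p ν :=
    (memLp_const ‖φ 0‖).add (hY.norm.const_mul (K : ℝ))
  exact hb.mono (hφ.continuous.comp_aestronglyMeasurable hY.1)
    (ae_of_all _ fun a => (norm_le_of_lipschitzWith hφ _).trans (le_abs_self _))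

section GaussianVector

variable {ι : Type*} [Fintype ι] [DecidableEq ι]

lemma integral_eval_mul_stdGaussian (i : ι) {φ : EuclideanSpace ℝ ι → ℝ} (hφ : ContDiff ℝ 1 φ)
    {K : ℝ≥0} (hK : LipschitzWith K φ) :
    ∫ x, x i * φ x ∂(stdGaussian (EuclideanSpace ℝ ι))
      = ∫ x, fderiv ℝ φ x (EuclideanSpace.single i 1) ∂(stdGaussian (EuclideanSpace ℝ ι)) := by
  have h2 : MemLp id 2 (stdGaussian (EuclideanSpace ℝ ι)) := IsGaussian.memLp_two_id
  have i0 : Integrable φ (stdGaussian (EuclideanSpace ℝ ι)) :=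
    (memLp_lipschitz_comp hK h2).integrable one_le_two
  have i1 : Integrable (fun x => x i * φ x) (stdGaussian (EuclideanSpace ℝ ι)) :=
    MemLp.integrable_mul (p := 2) (q := 2)
      ((EuclideanSpace.proj (𝕜 := ℝ) i).comp_memLp' h2) (memLp_lipschitz_comp hK h2)
  have c2 : Continuous fun x => fderiv ℝ φ x (EuclideanSpace.single i (1 : ℝ)) :=
    (hφ.continuous_fderiv one_ne_zero).clm_apply continuous_const
  have i2 : Integrable (fun x => fderiv ℝ φ x (EuclideanSpace.single i 1))
      (stdGaussian (EuclideanSpace ℝ ι)) := by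
    refine Integrable.of_bound c2.aestronglyMeasurable K (ae_of_all _ fun x => ?_)
    refine ((fderiv ℝ φ x).le_opNorm _).trans ?_
    simpa using norm_fderiv_le_of_lipschitz ℝ hK (x₀ := x)
  have hm : Measurable (WithLp.toLp 2 : (ι → ℝ) → EuclideanSpace ℝ ι) := by fun_prop
  rw [← map_pi_eq_stdGaussian] at i0 i1 i2 ⊢
  rw [integral_map hm.aemeasurable i1.1, integral_map hm.aemeasurable i2.1]
  refine integral_eval_mul_pi_gaussianReal i (ψ := fun x => φ (WithLp.toLp 2 x))
    (ψ' := fun x => fderiv ℝ φ (WithLp.toLp 2 x) (EuclideanSpace.single i 1)) (fun x t => ?_)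
    ((integrable_map_measure i0.1 hm.aemeasurable).1 i0)
    ((integrable_map_measure i1.1 hm.aemeasurable).1 i1)
    ((integrable_map_measure i2.1 hm.aemeasurable).1 i2)
  have hl : HasDerivAt (fun r : ℝ => (WithLp.toLp 2 (Function.update x i r) : EuclideanSpace ℝ ι))
      (EuclideanSpace.single i 1) t := by
    have := (PiLp.hasFDerivAt_toLp (𝕜 := ℝ) 2 (Function.update x i t)).comp_hasDerivAt t
      (hasDerivAt_update x i t)
    refine this.congr_deriv ?_
    ext j; simp
  exact ((hφ.differentiable one_ne_zero _).hasFDerivAt.comp_hasDerivAt t hl)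

lemma integral_inner_mul_stdGaussian (v : EuclideanSpace ℝ ι) {φ : EuclideanSpace ℝ ι → ℝ}
    (hφ : ContDiff ℝ 1 φ) {K : ℝ≥0} (hK : LipschitzWith K φ) :
    ∫ x, ⟪x, v⟫ * φ x ∂(stdGaussian (EuclideanSpace ℝ ι))
      = ∫ x, fderiv ℝ φ x v ∂(stdGaussian (EuclideanSpace ℝ ι)) := by
  have h2 : MemLp id 2 (stdGaussian (EuclideanSpace ℝ ι)) := IsGaussian.memLp_two_id
  have hv : v = ∑ i, v i • EuclideanSpace.single i (1 : ℝ) := by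
    ext j; simp [Pi.single_apply]
  have e1 : ∀ x : EuclideanSpace ℝ ι, ⟪x, v⟫ * φ x = ∑ i, v i * (x i * φ x) := fun x => by
    simp [PiLp.inner_apply, Finset.sum_mul, mul_assoc]
  have e2 : ∀ x, fderiv ℝ φ x v = ∑ i, v i * fderiv ℝ φ x (EuclideanSpace.single i 1) := fun x => by
    conv_lhs => rw [hv]
    simp
  simp_rw [e1, e2]
  rw [integral_finsetSum _ fun i _ => ?_, integral_finsetSum _ fun i _ => ?_]
  · simp_rw [integral_const_mul, integral_eval_mul_stdGaussian _ hφ hK]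
  · refine Integrable.const_mul ?_ _
    refine Integrable.of_bound ((hφ.continuous_fderiv one_ne_zero).clm_apply
      continuous_const).aestronglyMeasurable K (ae_of_all _ fun x => ?_)
    refine ((fderiv ℝ φ x).le_opNorm _).trans ?_
    simpa using norm_fderiv_le_of_lipschitz ℝ hK (x₀ := x)
  · exact Integrable.const_mul (MemLp.integrable_mul (p := 2) (q := 2)
      ((EuclideanSpace.proj (𝕜 := ℝ) i).comp_memLp' h2) (memLp_lipschitz_comp hK h2)) _

open scoped MatrixOrder in
/-- Integration by parts for a centred Gaussian vector with covariance matrix `C`. -/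
lemma integral_inner_mul_multivariateGaussian {C : Matrix ι ι ℝ} (hC : C.PosSemidef)
    (v : EuclideanSpace ℝ ι) {φ : EuclideanSpace ℝ ι → ℝ}
    (hφ : ContDiff ℝ 1 φ) {K : ℝ≥0} (hK : LipschitzWith K φ) :
    ∫ x, ⟪x, v⟫ * φ x ∂(multivariateGaussian 0 C)
      = ∫ x, fderiv ℝ φ x (Matrix.toEuclideanCLM (𝕜 := ℝ) C v) ∂(multivariateGaussian 0 C) := by
  set S := Matrix.toEuclideanCLM (n := ι) (𝕜 := ℝ) (CFC.sqrt C) with hS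
  have hSS : S ∘L S = Matrix.toEuclideanCLM (𝕜 := ℝ) C := by
    rw [← ContinuousLinearMap.mul_def, hS, ← map_mul, CFC.sqrt_mul_sqrt_self _ hC.nonneg]
  have hSa : ∀ x y, ⟪S x, y⟫ = ⟪x, S y⟫ := by
    have : IsSelfAdjoint S := (CFC.sqrt_nonneg C).isSelfAdjoint.map _
    intro x y
    rw [← ContinuousLinearMap.adjoint_inner_right, this.adjoint_eq]
  have hγ : multivariateGaussian 0 C = (stdGaussian (EuclideanSpace ℝ ι)).map S := by
    simp [multivariateGaussian, hS]
  have hc : Continuous fun x => fderiv ℝ φ x (Matrix.toEuclideanCLM (𝕜 := ℝ) C v) :=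
    (hφ.continuous_fderiv one_ne_zero).clm_apply continuous_const
  have hφc := hφ.continuous
  rw [hγ, integral_map (by fun_prop) (by fun_prop), integral_map (by fun_prop) (by fun_prop)]
  simp_rw [hSa]
  have := integral_inner_mul_stdGaussian (S v) (hφ.comp S.contDiff) (hK.comp S.lipschitz)
  simp only [Function.comp_def] at this
  rw [this]
  refine integral_congr_ae (ae_of_all _ fun x => ?_)
  have hd : HasFDerivAt (fun x => φ (S x)) ((fderiv ℝ φ (S x)).comp S) x :=
    (hφ.differentiable one_ne_zero _).hasFDerivAt.comp x S.hasFDerivAt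
  simp only [hd.fderiv, ← hSS, ContinuousLinearMap.comp_apply]

lemma toEuclideanCLM_inv_apply {C : Matrix ι ι ℝ} (hC : C.PosDef) (u : EuclideanSpace ℝ ι) :
    Matrix.toEuclideanCLM (𝕜 := ℝ) C (Matrix.toEuclideanCLM (𝕜 := ℝ) C⁻¹ u) = u := by
  rw [← ContinuousLinearMap.comp_apply, ← ContinuousLinearMap.mul_def, ← map_mul,
    Matrix.mul_nonsing_inv _ ((Matrix.isUnit_iff_isUnit_det _).1 hC.isUnit)]
  simp

/-- Gaussian integration by parts in the direction `u`, the score being `⟪C⁻¹ x, u⟫`. -/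
lemma integral_inner_inv_mul_multivariateGaussian {C : Matrix ι ι ℝ} (hC : C.PosDef)
    (u : EuclideanSpace ℝ ι) {φ : EuclideanSpace ℝ ι → ℝ}
    (hφ : ContDiff ℝ 1 φ) {K : ℝ≥0} (hK : LipschitzWith K φ) :
    ∫ x, ⟪x, Matrix.toEuclideanCLM (𝕜 := ℝ) C⁻¹ u⟫ * φ x ∂(multivariateGaussian 0 C)
      = ∫ x, fderiv ℝ φ x u ∂(multivariateGaussian 0 C) := by
  rw [integral_inner_mul_multivariateGaussian hC.posSemidef _ hφ hK, toEuclideanCLM_inv_apply hC]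

lemma integral_inner_inv_sq_multivariateGaussian {C : Matrix ι ι ℝ} (hC : C.PosDef)
    (u : EuclideanSpace ℝ ι) :
    ∫ x, ⟪x, Matrix.toEuclideanCLM (𝕜 := ℝ) C⁻¹ u⟫ ^ 2 ∂(multivariateGaussian 0 C)
      = ⟪u, Matrix.toEuclideanCLM (𝕜 := ℝ) C⁻¹ u⟫ := by
  set w := Matrix.toEuclideanCLM (𝕜 := ℝ) C⁻¹ u with hw
  have h := integral_inner_inv_mul_multivariateGaussian hC u (φ := fun x => innerSL ℝ w x)
    (innerSL ℝ w).contDiff (innerSL ℝ w).lipschitz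
  have hd : ∀ x, fderiv ℝ (fun x => innerSL ℝ w x) x u = ⟪w, u⟫ := fun x => by
    rw [show (fun x => innerSL ℝ w x) = ⇑(innerSL ℝ w) from rfl, ContinuousLinearMap.fderiv,
      innerSL_apply_apply]
  rw [integral_congr_ae (ae_of_all _ hd)] at h
  simp only [integral_const, probReal_univ, one_smul, innerSL_apply_apply] at h
  rw [← real_inner_comm, ← h]
  refine integral_congr_ae (ae_of_all _ fun x => ?_)
  simp only [← hw]
  rw [sq, real_inner_comm x w]

end GaussianVector

/-! ### Independent Poisson counts -/

lemma mul_poissonMeasure_succ (r : ℝ≥0) (n : ℕ) :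
    ((n + 1 : ℕ) : ℝ≥0∞) * poissonMeasure r {n + 1} = r * poissonMeasure r {n} := by
  rw [poissonMeasure_singleton, poissonMeasure_singleton, ← ENNReal.ofReal_natCast,
    ← ENNReal.ofReal_coe_nnreal, ← ENNReal.ofReal_mul (by positivity),
    ← ENNReal.ofReal_mul (by positivity), Nat.factorial_succ]
  congr 1
  push_cast
  field_simp
  ring

section Counts

variable {ι : Type*} [Fintype ι] [DecidableEq ι] (lam : ι → ℝ≥0)

/-- The joint law of independent Poisson counts with intensities `lam`. -/
noncomputable def poissonPi : Measure (ι → ℕ) := Measure.pi fun i => poissonMeasure (lam i)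

instance : IsProbabilityMeasure (poissonPi lam) := by
  unfold poissonPi; infer_instance

/-- The Mecke formula for independent Poisson counts, as an identity of measures: weighting by the
`k`-th count is the same as adding one point to the `k`-th cell and multiplying by its intensity. -/
lemma withDensity_poissonPi (k : ι) :
    (poissonPi lam).withDensity (fun n => ((n k : ℝ≥0) : ℝ≥0∞))
      = lam k • (poissonPi lam).map (fun n => n + Pi.single k 1) := by
  refine Measure.ext_of_singleton fun n => ?_
  rw [withDensity_apply _ (measurableSet_singleton n), lintegral_singleton, Measure.smul_apply,
    Measure.map_apply .of_discrete (measurableSet_singleton n)]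
  rcases Nat.eq_zero_or_pos (n k) with h | h
  · have : (fun m : ι → ℕ => m + Pi.single k 1) ⁻¹' {n} = ∅ := by
      ext m
      simp only [Set.mem_preimage, Set.mem_singleton_iff, Set.mem_empty_iff_false, iff_false]
      intro e
      have := congrFun e k
      simp [h] at this
    simp [h, this]
  · obtain ⟨m, rfl⟩ : ∃ m : ι → ℕ, n = m + Pi.single k 1 := by
      refine ⟨Function.update n k (n k - 1), ?_⟩
      ext j
      by_cases hj : j = k
      · subst hj; simp; omega
      · simp [hj]
    have : (fun m : ι → ℕ => m + Pi.single k 1) ⁻¹' {m + Pi.single k 1} = {m} := by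
      ext m'; simp
    rw [this, poissonPi, Measure.pi_singleton, Measure.pi_singleton,
      ← Finset.mul_prod_erase _ _ (Finset.mem_univ k),
      ← Finset.mul_prod_erase _ (fun i => poissonMeasure (lam i) {m i}) (Finset.mem_univ k)]
    have e := mul_poissonMeasure_succ (lam k) (m k)
    have e2 : ∏ x ∈ Finset.univ.erase k, poissonMeasure (lam x) {(m + Pi.single k 1 : ι → ℕ) x}
        = ∏ x ∈ Finset.univ.erase k, poissonMeasure (lam x) {m x} := by
      refine Finset.prod_congr rfl fun j hj => ?_
      simp [Finset.ne_of_mem_erase hj]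
    rw [e2, ← mul_assoc]
    simp only [Pi.add_apply, Pi.single_eq_same, ENNReal.smul_def, smul_eq_mul, ← mul_assoc,
      ENNReal.coe_natCast]
    rw [e]

/-- The Mecke formula for functions of Poisson counts and of an independent variable. -/
lemma integral_eval_mul_poissonPi_prod {E : Type*} [MeasurableSpace E] {γ : Measure E}
    [IsProbabilityMeasure γ] (k : ι) {f : (ι → ℕ) × E → ℝ} (hf : Measurable f) :
    ∫ p, (p.1 k : ℝ) * f p ∂((poissonPi lam).prod γ)
      = lam k * ∫ p, f (p.1 + Pi.single k 1, p.2) ∂((poissonPi lam).prod γ) := by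
  have hm : Measurable fun p : (ι → ℕ) × E => (p.1 + Pi.single k 1, p.2) :=
    (Measurable.of_discrete (f := fun n : ι → ℕ => n + Pi.single k 1)).prodMap measurable_id
  have hk : Measurable fun p : (ι → ℕ) × E => (p.1 k : ℝ≥0) :=
    (Measurable.of_discrete (f := fun n : ι → ℕ => (n k : ℝ≥0))).comp measurable_fst
  have e : ((poissonPi lam).prod γ).withDensity (fun p => ((p.1 k : ℝ≥0) : ℝ≥0∞))
      = lam k • ((poissonPi lam).prod γ).map (fun p => (p.1 + Pi.single k 1, p.2)) := by
    have e1 := prod_withDensity_left (μ := poissonPi lam) (ν := γ)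
      (f := fun n => ((n k : ℝ≥0) : ℝ≥0∞)) .of_discrete
    rw [← e1, withDensity_poissonPi]
    have e2 := Measure.map_prod_map (poissonPi lam) γ
      (Measurable.of_discrete (f := fun n : ι → ℕ => n + Pi.single k 1)) measurable_id
    rw [Measure.map_id] at e2
    rw [show (fun p : (ι → ℕ) × E => (p.1 + Pi.single k 1, p.2))
      = Prod.map (fun n : ι → ℕ => n + Pi.single k 1) id from rfl, ← e2]
    simp only [ENNReal.smul_def]
    rw [Measure.prod_smul_left]
  have h := integral_withDensity_eq_integral_smul (μ := (poissonPi lam).prod γ) hk f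
  rw [e, integral_smul_nnreal_measure, integral_map hm.aemeasurable hf.aestronglyMeasurable] at h
  simpa [NNReal.smul_def] using h.symm

lemma integral_eval_mul_poissonPi (k : ι) (f : (ι → ℕ) → ℝ) :
    ∫ n, (n k : ℝ) * f n ∂(poissonPi lam)
      = lam k * ∫ n, f (n + Pi.single k 1) ∂(poissonPi lam) := by
  have hk : Measurable fun n : ι → ℕ => (n k : ℝ≥0) := .of_discrete
  have h := integral_withDensity_eq_integral_smul (μ := poissonPi lam) hk f
  rw [withDensity_poissonPi, integral_smul_nnreal_measure,
    integral_map Measurable.of_discrete.aemeasurable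
      (Measurable.of_discrete (f := f)).aestronglyMeasurable] at h
  simpa [NNReal.smul_def] using h.symm

lemma lintegral_eval_mul_poissonPi (k : ι) (f : (ι → ℕ) → ℝ≥0∞) :
    ∫⁻ n, (n k : ℝ≥0∞) * f n ∂(poissonPi lam)
      = lam k * ∫⁻ n, f (n + Pi.single k 1) ∂(poissonPi lam) := by
  have h := lintegral_withDensity_eq_lintegral_mul (poissonPi lam)
    (f := fun n => ((n k : ℝ≥0) : ℝ≥0∞)) .of_discrete (g := f) .of_discrete
  rw [withDensity_poissonPi, lintegral_smul_measure,
    lintegral_map .of_discrete .of_discrete] at h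
  simpa [ENNReal.smul_def] using h.symm

lemma lintegral_eval_poissonPi (k : ι) : ∫⁻ n, (n k : ℝ≥0∞) ∂(poissonPi lam) = lam k := by
  simpa using lintegral_eval_mul_poissonPi lam k (fun _ => 1)

lemma memLp_eval_poissonPi (k : ι) : MemLp (fun n : ι → ℕ => (n k : ℝ)) 2 (poissonPi lam) := by
  refine ⟨Measurable.of_discrete.aestronglyMeasurable, ?_⟩
  rw [eLpNorm_lt_top_iff_lintegral_rpow_enorm_lt_top two_ne_zero ENNReal.ofNat_ne_top]
  have h : ∀ n : ι → ℕ, ‖(n k : ℝ)‖ₑ ^ (2 : ℝ≥0∞).toReal = (n k : ℝ≥0∞) * (n k : ℝ≥0∞) := by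
    intro n
    rw [Real.enorm_eq_ofReal (by positivity), ENNReal.ofReal_natCast]
    norm_num [sq]
  simp_rw [h]
  rw [lintegral_eval_mul_poissonPi lam k (fun n => (n k : ℝ≥0∞))]
  simp only [Pi.add_apply, Pi.single_eq_same, Nat.cast_add, Nat.cast_one]
  rw [lintegral_add_right _ measurable_const, lintegral_eval_poissonPi]
  simp [ENNReal.mul_lt_top_iff]

/-- The compensated sum `∑ₖ (nₖ - lamₖ) aₖ`. -/
def compSum {E : Type*} [AddCommGroup E] [Module ℝ E] (a : ι → E) (n : ι → ℕ) : E :=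
  ∑ k, ((n k : ℝ) - lam k) • a k

lemma compSum_add_single {E : Type*} [AddCommGroup E] [Module ℝ E] (a : ι → E) (n : ι → ℕ)
    (k : ι) : compSum lam a (n + Pi.single k 1) = compSum lam a n + a k := by
  unfold compSum
  rw [← Finset.add_sum_erase _ _ (Finset.mem_univ k),
    ← Finset.add_sum_erase _ (fun k => ((n k : ℝ) - lam k) • a k) (Finset.mem_univ k)]
  have : ∑ j ∈ Finset.univ.erase k, ((((n + Pi.single k 1 : ι → ℕ) j : ℕ) : ℝ) - lam j) • a j
      = ∑ j ∈ Finset.univ.erase k, ((n j : ℝ) - lam j) • a j := by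
    refine Finset.sum_congr rfl fun j hj => ?_
    simp [Finset.ne_of_mem_erase hj]
  rw [this]
  simp only [Pi.add_apply, Pi.single_eq_same, Nat.cast_add, Nat.cast_one]
  module

lemma memLp_compSum {E : Type*} [NormedAddCommGroup E] [NormedSpace ℝ E] (a : ι → E) :
    MemLp (compSum lam a) 2 (poissonPi lam) := by
  have h : compSum lam a = fun n : ι → ℕ => ∑ k, ((n k : ℝ) - lam k) • a k := rfl
  rw [h]
  refine memLp_finsetSum _ fun k _ => ?_
  have hk : MemLp (fun n : ι → ℕ => (n k : ℝ) - lam k) 2 (poissonPi lam) :=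
    (memLp_eval_poissonPi lam k).sub (memLp_const _)
  refine (hk.norm.mul_const ‖a k‖).of_le (hk.1.smul_const _) (ae_of_all _ fun n => ?_)
  simp [norm_smul]

/-- The Mecke formula against a function which adding a point to the `k`-th cell shifts by a
constant; the second moments of compensated sums follow from it. -/
lemma integral_compensated_mul_poissonPi (k : ι) {f : (ι → ℕ) → ℝ}
    (hf : MemLp f 2 (poissonPi lam)) (c : ℝ) (hc : ∀ n, f (n + Pi.single k 1) = f n + c) :
    ∫ n, ((n k : ℝ) - lam k) * f n ∂(poissonPi lam) = lam k * c := by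
  have i1 : Integrable (fun n : ι → ℕ => (n k : ℝ) * f n) (poissonPi lam) :=
    MemLp.integrable_mul (p := 2) (q := 2) (memLp_eval_poissonPi lam k) hf
  have i2 : Integrable f (poissonPi lam) := hf.integrable one_le_two
  simp_rw [sub_mul]
  rw [integral_sub i1 (i2.const_mul _), integral_eval_mul_poissonPi, integral_const_mul]
  simp_rw [hc]
  rw [integral_add i2 (integrable_const _)]
  simp
  ring

lemma integral_compSum_mul {a b : ι → ℝ} :
    ∫ n, compSum lam a n * compSum lam b n ∂(poissonPi lam) = ∑ k, lam k * (a k * b k) := by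
  have hb := memLp_compSum lam b
  have e : ∀ n, compSum lam a n * compSum lam b n
      = ∑ k, a k * (((n k : ℝ) - lam k) * compSum lam b n) := fun n => by
    conv_lhs => rw [compSum, Finset.sum_mul]
    exact Finset.sum_congr rfl fun k _ => by simp only [smul_eq_mul]; ring
  simp_rw [e]
  rw [integral_finsetSum]
  · refine Finset.sum_congr rfl fun k _ => ?_
    rw [integral_const_mul, integral_compensated_mul_poissonPi lam k hb (b k)
      fun n => compSum_add_single lam b n k]
    ring
  · intro k _
    have hk : MemLp (fun n : ι → ℕ => (n k : ℝ) - lam k) 2 (poissonPi lam) :=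
      (memLp_eval_poissonPi lam k).sub (memLp_const _)
    exact (MemLp.integrable_mul (p := 2) (q := 2) hk hb).const_mul _

lemma integral_compSum (a : ι → ℝ) : ∫ n, compSum lam a n ∂(poissonPi lam) = 0 := by
  have e : ∀ n, compSum lam a n = ∑ k, a k * (((n k : ℝ) - lam k) * (fun _ => 1) n) := fun n => by
    simp only [compSum, smul_eq_mul, mul_one]
    exact Finset.sum_congr rfl fun k _ => by ring
  simp_rw [e]
  rw [integral_finsetSum]
  · refine Finset.sum_eq_zero fun k _ => ?_
    rw [integral_const_mul, integral_compensated_mul_poissonPi lam k (memLp_const _) 0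
      fun n => by simp]
    ring
  · intro k _
    have hk : MemLp (fun n : ι → ℕ => (n k : ℝ) - lam k) 2 (poissonPi lam) :=
      (memLp_eval_poissonPi lam k).sub (memLp_const _)
    simpa using (hk.integrable one_le_two).const_mul _

end Counts

/-! ### The interpolation between the Poisson sum and the Gaussian vector -/

/-- The `L¹` norm is at most the `L²` norm on a probability space, in the form used
for the score. -/
lemma integral_abs_le_sqrt {α : Type*} [MeasurableSpace α] {ρ : Measure α} [IsProbabilityMeasure ρ]
    {f : α → ℝ} (hf : MemLp f 2 ρ) {b : ℝ} (hb : ∫ x, f x ^ 2 ∂ρ ≤ b) :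
    ∫ x, |f x| ∂ρ ≤ √b := by
  have h1 : Integrable (fun x => |f x|) ρ := (hf.integrable one_le_two).abs
  have h2 : Integrable (fun x => f x ^ 2) ρ := hf.integrable_sq
  refine Real.le_sqrt_of_sq_le (le_trans ?_ hb)
  -- the variance of `|f|` is nonnegative
  set m := ∫ x, |f x| ∂ρ with hm
  have h : 0 ≤ ∫ x, (|f x| - m) ^ 2 ∂ρ := integral_nonneg fun x => sq_nonneg _
  have e : ∀ x, (|f x| - m) ^ 2 = f x ^ 2 - (2 * m) * |f x| + m ^ 2 := fun x => by
    rw [← sq_abs (f x)]; ring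
  simp_rw [e] at h
  rw [integral_add (f := fun x => f x ^ 2 - 2 * m * |f x|) (h2.sub (h1.const_mul _))
    (integrable_const _), integral_sub h2 (h1.const_mul _), integral_const_mul, ← hm] at h
  simp at h
  nlinarith

lemma opNorm_nonneg {d : ℕ} (A : Matrix (Fin d) (Fin d) ℝ) : 0 ≤ opNorm A := norm_nonneg _

section Interpolation

variable {d : ℕ} {ι : Type*} [Fintype ι] [DecidableEq ι] (lam : ι → ℝ≥0)
  (c : ι → EuclideanSpace ℝ (Fin d)) (C : Matrix (Fin d) (Fin d) ℝ)

local notation "E" => EuclideanSpace ℝ (Fin d)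

/-- The law of independent Poisson counts and an independent Gaussian vector. -/
noncomputable def jointLaw : Measure ((ι → ℕ) × E) :=
  (poissonPi lam).prod (multivariateGaussian 0 C)

instance : IsProbabilityMeasure (jointLaw lam C) := by
  unfold jointLaw; infer_instance

/-- The interpolating vector `s F + κ X`, with `F` the compensated Poisson sum and `X` Gaussian. -/
noncomputable def mix (s κ : ℝ) (p : (ι → ℕ) × E) : E := s • compSum lam c p.1 + κ • p.2

lemma memLp_compSum_fst : MemLp (fun p : (ι → ℕ) × E => compSum lam c p.1) 2 (jointLaw lam C) :=
  (memLp_compSum lam c).comp_fst _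

omit [DecidableEq ι] in
lemma memLp_snd : MemLp (fun p : (ι → ℕ) × E => p.2) 2 (jointLaw lam C) :=
  (IsGaussian.memLp_two_id (μ := multivariateGaussian (0 : E) C)).comp_snd _

omit [DecidableEq ι] in
lemma measurable_mix (s κ : ℝ) : Measurable (mix lam c s κ) := by
  unfold mix
  exact (((Measurable.of_discrete (f := compSum lam c)).comp measurable_fst).const_smul s).add
    (measurable_snd.const_smul κ)

lemma memLp_mix (s κ : ℝ) : MemLp (mix lam c s κ) 2 (jointLaw lam C) :=
  ((memLp_compSum_fst lam c C).const_smul s).add ((memLp_snd lam C).const_smul κ)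

lemma memLp_comp_mix (s κ : ℝ) {φ : E → ℝ} {K : ℝ≥0} (hK : LipschitzWith K φ) :
    MemLp (fun p => φ (mix lam c s κ p)) 2 (jointLaw lam C) :=
  memLp_lipschitz_comp hK (memLp_mix lam c C s κ)

omit [DecidableEq ι] in
lemma memLp_inner_snd (v : E) : MemLp (fun p : (ι → ℕ) × E => ⟪p.2, v⟫) 2 (jointLaw lam C) :=
  (memLp_snd lam C).inner_const v

variable {C}

/-- Gaussian integration by parts for functions of the interpolating vector. -/
lemma integral_inner_mul_jointLaw (hC : C.PosSemidef) (s κ : ℝ) (v : E) {φ : E → ℝ}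
    (hφ : ContDiff ℝ 1 φ) {K : ℝ≥0} (hK : LipschitzWith K φ) :
    ∫ p, ⟪p.2, v⟫ * φ (mix lam c s κ p) ∂(jointLaw lam C)
      = κ * ∫ p, fderiv ℝ φ (mix lam c s κ p) (Matrix.toEuclideanCLM (𝕜 := ℝ) C v)
          ∂(jointLaw lam C) := by
  set u := Matrix.toEuclideanCLM (𝕜 := ℝ) C v with hu
  have i1 : Integrable (fun p => ⟪p.2, v⟫ * φ (mix lam c s κ p)) (jointLaw lam C) :=
    MemLp.integrable_mul (p := 2) (q := 2) (memLp_inner_snd lam C v) (memLp_comp_mix lam c C s κ hK)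
  have i2 : Integrable (fun p => fderiv ℝ φ (mix lam c s κ p) u) (jointLaw lam C) := by
    refine Integrable.of_bound ((((hφ.continuous_fderiv one_ne_zero).clm_apply
      continuous_const).measurable.comp (measurable_mix lam c s κ)).aestronglyMeasurable)
      (K * ‖u‖) (ae_of_all _ fun x => ?_)
    refine ((fderiv ℝ φ _).le_opNorm _).trans ?_
    gcongr
    exact norm_fderiv_le_of_lipschitz ℝ hK
  rw [← integral_const_mul]
  unfold jointLaw at i1 i2 ⊢
  rw [integral_prod _ i1, integral_prod _ (i2.const_mul κ)]
  refine integral_congr_ae (ae_of_all _ fun n => ?_)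
  have hl : LipschitzWith (K * ‖κ‖₊) fun x : E => φ (s • compSum lam c n + κ • x) := by
    refine hK.comp (LipschitzWith.of_dist_le_mul fun x y => ?_)
    simp [dist_eq_norm, ← smul_sub, norm_smul]
  have hd : ContDiff ℝ 1 fun x : E => φ (s • compSum lam c n + κ • x) :=
    hφ.comp (contDiff_const.add (contDiff_id.const_smul κ))
  simp only [mix]
  rw [integral_inner_mul_multivariateGaussian hC v hd hl]
  refine integral_congr_ae (ae_of_all _ fun x => ?_)
  have h1 : HasFDerivAt (fun x : E => s • compSum lam c n + κ • x)
      (κ • ContinuousLinearMap.id ℝ E) x :=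
    ((hasFDerivAt_id x).const_smul κ).const_add _
  have h2 := (hφ.differentiable one_ne_zero (s • compSum lam c n + κ • x)).hasFDerivAt.comp x h1
  simp only [Function.comp_def] at h2
  simp only [h2.fderiv, ContinuousLinearMap.comp_apply, smul_apply,
    ContinuousLinearMap.id_apply, map_smul, smul_eq_mul, hu]

omit [DecidableEq ι] in
lemma integral_score_sq_le (hC : C.PosDef) (u : E) :
    ∫ p, ⟪p.2, Matrix.toEuclideanCLM (𝕜 := ℝ) C⁻¹ u⟫ ^ 2 ∂(jointLaw lam C)
      ≤ opNorm C⁻¹ * ‖u‖ ^ 2 := by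
  unfold jointLaw
  rw [integral_fun_snd (f := fun x : E => ⟪x, Matrix.toEuclideanCLM (𝕜 := ℝ) C⁻¹ u⟫ ^ 2)]
  rw [integral_inner_inv_sq_multivariateGaussian hC u, probReal_univ, one_smul]
  calc ⟪u, Matrix.toEuclideanCLM (𝕜 := ℝ) C⁻¹ u⟫
      ≤ ‖u‖ * ‖Matrix.toEuclideanCLM (𝕜 := ℝ) C⁻¹ u‖ := real_inner_le_norm _ _
    _ ≤ ‖u‖ * (opNorm C⁻¹ * ‖u‖) := by
        gcongr
        exact ContinuousLinearMap.le_opNorm _ _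
    _ = _ := by ring

omit [DecidableEq ι] in
lemma integral_abs_score_le (hC : C.PosDef) (u : E) :
    ∫ p, |⟪p.2, Matrix.toEuclideanCLM (𝕜 := ℝ) C⁻¹ u⟫| ∂(jointLaw lam C)
      ≤ √(opNorm C⁻¹) * ‖u‖ := by
  refine (integral_abs_le_sqrt (memLp_inner_snd lam C _) (integral_score_sq_le lam hC u)).trans ?_
  rw [Real.sqrt_mul (opNorm_nonneg _), Real.sqrt_sq (norm_nonneg _)]

/-- The vector fields to which the interpolation applies: `C¹`, bounded by `1` and `1`-Lipschitz,
as are the gradients of the test functions. -/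
structure IsTestField (G : E → E) : Prop where
  contDiff : ContDiff ℝ 1 G
  norm_le : ∀ x, ‖G x‖ ≤ 1
  lipschitz : LipschitzWith 1 G

lemma inner_single_one (i : Fin d) (v : E) :
    ⟪EuclideanSpace.single i (1 : ℝ), v⟫ = v i := by
  simp [PiLp.inner_apply]

variable {G : EuclideanSpace ℝ (Fin d) → EuclideanSpace ℝ (Fin d)}

lemma IsTestField.norm_fderiv_le (hG : IsTestField G) (x : E) : ‖fderiv ℝ G x‖ ≤ 1 := by
  simpa using norm_fderiv_le_of_lipschitz ℝ hG.lipschitz (x₀ := x)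

lemma IsTestField.translate (hG : IsTestField G) (a : E) : IsTestField fun y => G (y + a) where
  contDiff := hG.contDiff.comp (contDiff_id.add contDiff_const)
  norm_le x := hG.norm_le _
  lipschitz := LipschitzWith.of_dist_le_mul fun x y => by
    simpa using hG.lipschitz.dist_le_mul (x + a) (y + a)

lemma IsTestField.contDiff_inner (hG : IsTestField G) (u : E) :
    ContDiff ℝ 1 fun y => ⟪u, G y⟫ :=
  contDiff_const.inner ℝ hG.contDiff

lemma IsTestField.lipschitz_inner (hG : IsTestField G) (u : E) :
    LipschitzWith ‖u‖₊ fun y => ⟪u, G y⟫ := by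
  refine LipschitzWith.of_dist_le_mul fun x y => ?_
  rw [Real.dist_eq, ← inner_sub_right]
  refine (abs_real_inner_le_norm _ _).trans ?_
  rw [coe_nnnorm]
  gcongr
  simpa [dist_eq_norm] using hG.lipschitz.dist_le_mul x y

lemma IsTestField.fderiv_inner (hG : IsTestField G) (u v x : E) :
    fderiv ℝ (fun y => ⟪u, G y⟫) x v = ⟪u, fderiv ℝ G x v⟫ := by
  have h := ((innerSL ℝ u).hasFDerivAt (x := G x)).comp x
    (hG.contDiff.differentiable one_ne_zero x).hasFDerivAt
  have h' : HasFDerivAt (fun y => ⟪u, G y⟫) ((innerSL ℝ u).comp (fderiv ℝ G x)) x := h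
  rw [h'.fderiv]
  simp

/-- The expected Jacobian of `G` at the interpolating vector. -/
noncomputable def meanJacobian (C : Matrix (Fin d) (Fin d) ℝ) (G : E → E) (s κ : ℝ) : E →L[ℝ] E :=
  ∫ p, fderiv ℝ G (mix lam c s κ p) ∂(jointLaw lam C)

omit [DecidableEq ι] in
lemma measurable_comp_mix (hG : IsTestField G) (s κ : ℝ) :
    Measurable fun p => G (mix lam c s κ p) :=
  hG.contDiff.continuous.measurable.comp (measurable_mix lam c s κ)

omit [DecidableEq ι] in
lemma integrable_fderiv_mix (hG : IsTestField G) (s κ : ℝ) :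
    Integrable (fun p => fderiv ℝ G (mix lam c s κ p)) (jointLaw lam C) := by
  refine Integrable.of_bound ?_ 1 (ae_of_all _ fun p => hG.norm_fderiv_le _)
  exact (hG.contDiff.continuous_fderiv one_ne_zero).stronglyMeasurable.comp_measurable
    (measurable_mix lam c s κ) |>.aestronglyMeasurable

omit [DecidableEq ι] in
lemma integral_inner_fderiv_mix (hG : IsTestField G) (s κ : ℝ) (u v : E) :
    ∫ p, ⟪u, fderiv ℝ G (mix lam c s κ p) v⟫ ∂(jointLaw lam C)
      = ⟪u, meanJacobian lam c C G s κ v⟫ := by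
  have h := integrable_fderiv_mix (C := C) lam c hG s κ
  rw [meanJacobian, ContinuousLinearMap.integral_apply h,
    ← integral_inner (h.apply_continuousLinearMap v)]

/-- The score identity for the mean Jacobian: derivatives of `G` are traded for the Gaussian
score. -/
lemma mul_inner_meanJacobian (hC : C.PosDef) (hG : IsTestField G) (s κ : ℝ) (u v : E) :
    κ * ⟪u, meanJacobian lam c C G s κ v⟫
      = ∫ p, ⟪p.2, Matrix.toEuclideanCLM (𝕜 := ℝ) C⁻¹ v⟫ * ⟪u, G (mix lam c s κ p)⟫
          ∂(jointLaw lam C) := by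
  rw [integral_inner_mul_jointLaw lam c hC.posSemidef s κ _ (hG.contDiff_inner u)
    (hG.lipschitz_inner u), toEuclideanCLM_inv_apply hC]
  simp_rw [hG.fderiv_inner]
  rw [integral_inner_fderiv_mix lam c hG]

lemma integral_inner_snd_mix (hC : C.PosDef) (hG : IsTestField G) (s κ : ℝ) :
    ∫ p, ⟪p.2, G (mix lam c s κ p)⟫ ∂(jointLaw lam C)
      = κ * ∑ i, ∑ j, C i j * meanJacobian lam c C G s κ (EuclideanSpace.single j 1) i := by
  have e : ∀ p : (ι → ℕ) × E, ⟪p.2, G (mix lam c s κ p)⟫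
      = ∑ i, ⟪p.2, EuclideanSpace.single i (1 : ℝ)⟫
        * ⟪EuclideanSpace.single i (1 : ℝ), G (mix lam c s κ p)⟫ := fun p => by
    simp [PiLp.inner_apply, mul_comm]
  simp_rw [e]
  rw [integral_finsetSum, Finset.mul_sum]
  · refine Finset.sum_congr rfl fun i _ => ?_
    rw [integral_inner_mul_jointLaw lam c hC.posSemidef s κ _ (hG.contDiff_inner _)
      (hG.lipschitz_inner _)]
    simp_rw [hG.fderiv_inner]
    rw [integral_inner_fderiv_mix lam c hG]
    congr 1
    have : Matrix.toEuclideanCLM (𝕜 := ℝ) C (EuclideanSpace.single i 1)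
        = ∑ j, C i j • EuclideanSpace.single j (1 : ℝ) := by
      ext j
      have hs : C j i = C i j := by
        have := congrFun (congrFun hC.isHermitian j) i
        simpa [Matrix.conjTranspose_apply] using this.symm
      simp [Matrix.ofLp_toEuclideanCLM, Pi.single_apply, hs]
    rw [this, map_sum, inner_single_one]
    simp
  · intro i _
    exact MemLp.integrable_mul (p := 2) (q := 2) (memLp_inner_snd lam C _)
      (memLp_comp_mix lam c C s κ (hG.lipschitz_inner _))

lemma hsNorm_eq (A : Matrix (Fin d) (Fin d) ℝ) : hsNorm A = √(∑ i, ∑ j, A i j ^ 2) := by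
  simp [hsNorm, Matrix.trace, Matrix.mul_apply, sq]

/-- Pairing a matrix with the mean Jacobian costs its Hilbert-Schmidt norm only: by the score
identity just the bound on `G`, not on its derivative, is used. -/
lemma abs_mul_sum_meanJacobian_le (hC : C.PosDef) (hG : IsTestField G) (s κ : ℝ)
    (A : Matrix (Fin d) (Fin d) ℝ) :
    |κ * ∑ i, ∑ j, A i j * meanJacobian lam c C G s κ (EuclideanSpace.single j 1) i|
      ≤ √(opNorm C⁻¹) * hsNorm A := by
  -- the `i`-th coordinate of `Z` is the score in the direction of the `i`-th row of `A`
  set a : Fin d → E := fun i => WithLp.toLp 2 (A i) with ha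
  set Z : (ι → ℕ) × E → E := fun p =>
    WithLp.toLp 2 fun i => ⟪p.2, Matrix.toEuclideanCLM (𝕜 := ℝ) C⁻¹ (a i)⟫ with hZ
  have hZi : ∀ i, MemLp (fun p => Z p i) 2 (jointLaw lam C) := fun i =>
    memLp_inner_snd lam C (Matrix.toEuclideanCLM (𝕜 := ℝ) C⁻¹ (a i))
  have hGi : ∀ i, MemLp (fun p => G (mix lam c s κ p) i) 2 (jointLaw lam C) := fun i => by
    have := memLp_comp_mix lam c C s κ (hG.lipschitz_inner (EuclideanSpace.single i 1))
    simpa only [inner_single_one] using this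
  have e1 : κ * ∑ i, ∑ j, A i j * meanJacobian lam c C G s κ (EuclideanSpace.single j 1) i
      = ∫ p, ⟪G (mix lam c s κ p), Z p⟫ ∂(jointLaw lam C) := by
    have e2 : ∀ i, κ * ∑ j, A i j * meanJacobian lam c C G s κ (EuclideanSpace.single j 1) i
        = ∫ p, Z p i * G (mix lam c s κ p) i ∂(jointLaw lam C) := fun i => by
      have h := mul_inner_meanJacobian lam c hC hG s κ (EuclideanSpace.single i 1) (a i)
      have ea : a i = ∑ j, A i j • EuclideanSpace.single j (1 : ℝ) := by
        ext j; simp [ha, Pi.single_apply]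
      have e3 : ⟪EuclideanSpace.single i (1 : ℝ), meanJacobian lam c C G s κ (a i)⟫
          = ∑ j, A i j * meanJacobian lam c C G s κ (EuclideanSpace.single j 1) i := by
        rw [ea, map_sum, inner_single_one]
        simp
      rw [e3] at h
      rw [h]
      simp only [inner_single_one, hZ]
    rw [Finset.mul_sum, Finset.sum_congr rfl fun i _ => e2 i, ← integral_finsetSum
      (f := fun i p => Z p i * G (mix lam c s κ p) i) _ fun i _ =>
        MemLp.integrable_mul (p := 2) (q := 2) (hZi i) (hGi i)]
    refine integral_congr_ae (ae_of_all _ fun p => ?_)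
    simp [PiLp.inner_apply]
  have hZsq : ∀ p, ‖Z p‖ ^ 2 = ∑ i, Z p i ^ 2 := fun p => EuclideanSpace.real_norm_sq_eq _
  have hZm : MemLp (fun p => ‖Z p‖) 2 (jointLaw lam C) := by
    have hm : Measurable Z := by fun_prop
    rw [memLp_two_iff_integrable_sq hm.norm.aestronglyMeasurable]
    simp_rw [hZsq]
    exact integrable_finsetSum _ fun i _ => (hZi i).integrable_sq
  have hb : ∫ p, ‖Z p‖ ^ 2 ∂(jointLaw lam C) ≤ opNorm C⁻¹ * ∑ i, ∑ j, A i j ^ 2 := by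
    simp_rw [hZsq]
    rw [integral_finsetSum _ fun i _ => (hZi i).integrable_sq, Finset.mul_sum]
    refine Finset.sum_le_sum fun i _ => ?_
    refine (integral_score_sq_le lam hC (a i)).trans_eq ?_
    rw [EuclideanSpace.real_norm_sq_eq]
  rw [e1]
  calc |∫ p, ⟪G (mix lam c s κ p), Z p⟫ ∂(jointLaw lam C)|
      ≤ ∫ p, |‖Z p‖| ∂(jointLaw lam C) := by
        rw [← Real.norm_eq_abs]
        refine norm_integral_le_of_norm_le (hZm.integrable one_le_two).abs
          (ae_of_all _ fun p => ?_)
        rw [Real.norm_eq_abs, abs_norm]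
        refine (abs_real_inner_le_norm _ _).trans ?_
        exact mul_le_of_le_one_left (norm_nonneg _) (hG.norm_le _)
    _ ≤ √(opNorm C⁻¹ * ∑ i, ∑ j, A i j ^ 2) := integral_abs_le_sqrt hZm hb
    _ = _ := by rw [Real.sqrt_mul (opNorm_nonneg _), hsNorm_eq]

end Interpolation

section Remainder

variable {d : ℕ} {ι : Type*} [Fintype ι] [DecidableEq ι] (lam : ι → ℝ≥0)
  (c : ι → EuclideanSpace ℝ (Fin d)) {C : Matrix (Fin d) (Fin d) ℝ}
  {G : EuclideanSpace ℝ (Fin d) → EuclideanSpace ℝ (Fin d)}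

local notation "E" => EuclideanSpace ℝ (Fin d)

lemma integrable_inner_mix (hG : IsTestField G) (s κ : ℝ) (u : E) :
    Integrable (fun p => ⟪u, G (mix lam c s κ p)⟫) (jointLaw lam C) :=
  (memLp_comp_mix lam c C s κ (hG.lipschitz_inner u)).integrable one_le_two

lemma hasDerivAt_integral_inner_translate (hG : IsTestField G) (s κ : ℝ) (w : E) (a : ℝ) :
    HasDerivAt (fun a : ℝ => ∫ p, ⟪w, G (mix lam c s κ p + a • w)⟫ ∂(jointLaw lam C))
      ⟪w, meanJacobian lam c C (fun y => G (y + a • w)) s κ w⟫ a := by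
  have hf : ∀ a : ℝ, ∀ y, fderiv ℝ (fun y => G (y + a • w)) y = fderiv ℝ G (y + a • w) :=
    fun a y => fderiv_comp_add_right _
  rw [← integral_inner_fderiv_mix lam c (hG.translate (a • w))]
  simp_rw [hf]
  refine (hasDerivAt_integral_of_dominated_loc_of_deriv_le (bound := fun _ => ‖w‖ * ‖w‖)
    (F' := fun a p => ⟪w, fderiv ℝ G (mix lam c s κ p + a • w) w⟫) (s := Set.univ) univ_mem
    (Eventually.of_forall fun a =>
      (integrable_inner_mix lam c (hG.translate (a • w)) s κ w).1)
    (integrable_inner_mix lam c (hG.translate (a • w)) s κ w) ?_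
    (ae_of_all _ fun p x _ => ?_) (integrable_const _) (ae_of_all _ fun p x _ => ?_)).2
  · have hc : Continuous fun y => ⟪w, fderiv ℝ G (y + a • w) w⟫ :=
      continuous_const.inner (((hG.contDiff.continuous_fderiv one_ne_zero).comp
        (continuous_id.add continuous_const)).clm_apply continuous_const)
    exact (hc.measurable.comp (measurable_mix lam c s κ)).aestronglyMeasurable
  · refine (abs_real_inner_le_norm _ _).trans ?_
    gcongr
    refine (ContinuousLinearMap.le_opNorm _ _).trans ?_
    exact mul_le_of_le_one_left (norm_nonneg _) (hG.norm_fderiv_le _)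
  · have hl : HasDerivAt (fun a : ℝ => mix lam c s κ p + a • w) w x := by
      simpa using ((hasDerivAt_id x).smul_const w).const_add (mix lam c s κ p)
    have := (hG.contDiff.differentiable one_ne_zero (mix lam c s κ p + x • w)).hasFDerivAt
      |>.comp_hasDerivAt x hl
    simpa using (hasDerivAt_const x w).inner ℝ this

/-- Second-order Taylor remainder in the direction `w`. The third derivative of the smoothed test
function is replaced by the Gaussian score acting on an increment of `G`. -/
lemma abs_taylor_remainder_le (hC : C.PosDef) (hG : IsTestField G) {s : ℝ} (hs : 0 ≤ s)
    (κ : ℝ) (w : E) :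
    |κ * (∫ p, ⟪w, G (mix lam c s κ p + s • w)⟫ ∂(jointLaw lam C)
        - ∫ p, ⟪w, G (mix lam c s κ p)⟫ ∂(jointLaw lam C)
        - s * ⟪w, meanJacobian lam c C G s κ w⟫)|
      ≤ √(opNorm C⁻¹) * ‖w‖ ^ 3 * s ^ 2 / 2 := by
  set r : ℝ → ℝ := fun a => ∫ p, ⟪w, G (mix lam c s κ p + a • w)⟫ ∂(jointLaw lam C) with hr
  set T : ℝ → ℝ := fun a => ⟪w, meanJacobian lam c C (fun y => G (y + a • w)) s κ w⟫ with hT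
  have hr0 : r 0 = ∫ p, ⟪w, G (mix lam c s κ p)⟫ ∂(jointLaw lam C) := by simp [hr]
  have hT0 : T 0 = ⟪w, meanJacobian lam c C G s κ w⟫ := by simp [hT]
  have hd : ∀ a, HasDerivAt (fun a => κ * (r a - r 0 - a * T 0)) (κ * (T a - T 0)) a := fun a => by
    have h := hasDerivAt_integral_inner_translate (C := C) lam c hG s κ w a
    exact (((h.sub_const (r 0)).sub
      ((hasDerivAt_id a).mul_const (T 0))).const_mul κ).congr_deriv (by simp [hT])
  -- the score identity for `G` and for its translate by `a • w` leaves an increment of `G`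
  have hbound : ∀ a ∈ Set.Ico 0 s, ‖κ * (T a - T 0)‖ ≤ √(opNorm C⁻¹) * ‖w‖ ^ 3 * a := by
    rintro a ⟨ha, -⟩
    have i1 : ∀ b : ℝ, Integrable (fun p => ⟪p.2, Matrix.toEuclideanCLM (𝕜 := ℝ) C⁻¹ w⟫
        * ⟪w, G (mix lam c s κ p + b • w)⟫) (jointLaw lam C) := fun b =>
      MemLp.integrable_mul (p := 2) (q := 2) (memLp_inner_snd lam C _)
        (memLp_comp_mix lam c C s κ ((hG.translate (b • w)).lipschitz_inner w))
    have e : κ * (T a - T 0) = ∫ p, ⟪p.2, Matrix.toEuclideanCLM (𝕜 := ℝ) C⁻¹ w⟫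
        * (⟪w, G (mix lam c s κ p + a • w)⟫ - ⟪w, G (mix lam c s κ p + (0 : ℝ) • w)⟫)
          ∂(jointLaw lam C) := by
      simp_rw [mul_sub]
      rw [integral_sub (i1 a) (i1 0)]
      simp only [hT]
      rw [mul_inner_meanJacobian lam c hC (hG.translate _),
        mul_inner_meanJacobian lam c hC (hG.translate _)]
    rw [e]
    have hi : Integrable (fun p : (ι → ℕ) × E => |⟪p.2, Matrix.toEuclideanCLM (𝕜 := ℝ) C⁻¹ w⟫|)
      (jointLaw lam C) := ((memLp_inner_snd lam C _).integrable one_le_two).abs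
    calc _ ≤ ∫ p, |⟪p.2, Matrix.toEuclideanCLM (𝕜 := ℝ) C⁻¹ w⟫| * (‖w‖ ^ 2 * a)
          ∂(jointLaw lam C) := by
          refine norm_integral_le_of_norm_le (hi.mul_const _) (ae_of_all _ fun p => ?_)
          rw [norm_mul, Real.norm_eq_abs]
          gcongr
          rw [← inner_sub_right]
          refine (abs_real_inner_le_norm _ _).trans ?_
          have := hG.lipschitz.dist_le_mul (mix lam c s κ p + a • w) (mix lam c s κ p + (0 : ℝ) • w)
          rw [dist_eq_norm, dist_eq_norm] at this
          have e2 : mix lam c s κ p + a • w - (mix lam c s κ p + (0 : ℝ) • w) = a • w := by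
            simp
          rw [e2, norm_smul, Real.norm_of_nonneg ha] at this
          calc _ ≤ ‖w‖ * (1 * (a * ‖w‖)) := by gcongr; simpa using this
            _ = _ := by ring
      _ ≤ (√(opNorm C⁻¹) * ‖w‖) * (‖w‖ ^ 2 * a) := by
          rw [integral_mul_const]
          gcongr
          exact integral_abs_score_le lam hC w
      _ = _ := by ring
  have h := image_norm_le_of_norm_deriv_right_le_deriv_boundary
    (f := fun a => κ * (r a - r 0 - a * T 0)) (f' := fun a => κ * (T a - T 0)) (a := 0) (b := s)
    (B := fun a => √(opNorm C⁻¹) * ‖w‖ ^ 3 * a ^ 2 / 2)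
    (B' := fun a => √(opNorm C⁻¹) * ‖w‖ ^ 3 * a)
    (fun a _ => (hd a).continuousAt.continuousWithinAt) (fun a _ => (hd a).hasDerivWithinAt)
    (by simp) (fun a => ((((hasDerivAt_pow 2 a).const_mul _).div_const 2).congr_deriv
      (by simp; ring))) hbound (x := s) ⟨hs, le_rfl⟩
  rw [Real.norm_eq_abs] at h
  rwa [hr0, hT0] at h

/-- Integration by parts for the compensated Poisson sum. -/
lemma integral_inner_compSum_mix (hG : IsTestField G) (s κ : ℝ) :
    ∫ p, ⟪compSum lam c p.1, G (mix lam c s κ p)⟫ ∂(jointLaw lam C)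
      = ∑ k, lam k * (∫ p, ⟪c k, G (mix lam c s κ p + s • c k)⟫ ∂(jointLaw lam C)
          - ∫ p, ⟪c k, G (mix lam c s κ p)⟫ ∂(jointLaw lam C)) := by
  have e : ∀ p : (ι → ℕ) × E, ⟪compSum lam c p.1, G (mix lam c s κ p)⟫
      = ∑ k, ((p.1 k : ℝ) * ⟪c k, G (mix lam c s κ p)⟫
        - lam k * ⟪c k, G (mix lam c s κ p)⟫) := fun p => by
    rw [compSum, sum_inner]
    exact Finset.sum_congr rfl fun k _ => by rw [real_inner_smul_left, sub_mul]
  have i1 : ∀ k, Integrable (fun p => (p.1 k : ℝ) * ⟪c k, G (mix lam c s κ p)⟫)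
      (jointLaw lam C) := fun k =>
    MemLp.integrable_mul (p := 2) (q := 2)
      (f := fun p : (ι → ℕ) × E => (p.1 k : ℝ)) ((memLp_eval_poissonPi lam k).comp_fst _)
      (memLp_comp_mix lam c C s κ (hG.lipschitz_inner _))
  have i2 : ∀ k, Integrable (fun p => ⟪c k, G (mix lam c s κ p)⟫)
      (jointLaw lam C) := fun k => integrable_inner_mix lam c hG s κ _
  simp_rw [e]
  rw [integral_finsetSum (f := fun k p => (p.1 k : ℝ) * ⟪c k, G (mix lam c s κ p)⟫
    - lam k * ⟪c k, G (mix lam c s κ p)⟫) _ fun k _ => (i1 k).sub ((i2 k).const_mul _)]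
  refine Finset.sum_congr rfl fun k _ => ?_
  rw [integral_sub (i1 k) ((i2 k).const_mul _), integral_const_mul, mul_sub]
  congr 1
  rw [jointLaw, integral_eval_mul_poissonPi_prod lam k
    (f := fun p => ⟪c k, G (mix lam c s κ p)⟫)]
  · congr 2
    ext p
    rw [show mix lam c s κ (p.1 + Pi.single k 1, p.2) = mix lam c s κ p + s • c k by
      simp only [mix, compSum_add_single]
      module]
  · exact ((innerSL ℝ (c k)).continuous.measurable).comp (measurable_comp_mix lam c hG s κ)

/-- The covariance matrix of the compensated Poisson sum. -/
noncomputable def compCov : Matrix (Fin d) (Fin d) ℝ :=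
  Matrix.of fun i j => ∑ k, (lam k : ℝ) * (c k i * c k j)

lemma hsNorm_sub_comm (A B : Matrix (Fin d) (Fin d) ℝ) : hsNorm (A - B) = hsNorm (B - A) := by
  rw [hsNorm_eq, hsNorm_eq]
  congr 1
  refine Finset.sum_congr rfl fun i _ => Finset.sum_congr rfl fun j _ => ?_
  simp only [Matrix.sub_apply]
  ring

/-- The bound on the speed of the interpolation `sin θ • F + cos θ • X`, with `s = sin θ` and
`κ = cos θ`. The terms of second order combine to the pairing of `compCov - C` with the mean
Jacobian, and the Taylor remainders make up the sum of cubes. -/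
lemma abs_integral_speed_le (hC : C.PosDef) (hG : IsTestField G) {s κ : ℝ} (hs : 0 ≤ s)
    (hs1 : s ≤ 1) :
    |∫ p, ⟪κ • compSum lam c p.1 - s • p.2, G (mix lam c s κ p)⟫ ∂(jointLaw lam C)|
      ≤ √(opNorm C⁻¹) * (hsNorm (C - compCov lam c) + 1 / 2 * ∑ k, lam k * ‖c k‖ ^ 3) * s := by
  have hGm : Measurable fun p => G (mix lam c s κ p) := measurable_comp_mix lam c hG s κ
  have i1 : Integrable (fun p => ⟪compSum lam c p.1, G (mix lam c s κ p)⟫) (jointLaw lam C) := by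
    refine ((memLp_compSum_fst lam c C).integrable one_le_two).norm.mono
      ((memLp_compSum_fst lam c C).1.inner hGm.aestronglyMeasurable) (ae_of_all _ fun p => ?_)
    rw [norm_norm]
    exact (norm_inner_le_norm _ _).trans (mul_le_of_le_one_right (norm_nonneg _) (hG.norm_le _))
  have i2 : Integrable (fun p : (ι → ℕ) × E => ⟪p.2, G (mix lam c s κ p)⟫) (jointLaw lam C) := by
    refine ((memLp_snd lam C).integrable one_le_two).norm.mono
      ((memLp_snd lam C).1.inner hGm.aestronglyMeasurable) (ae_of_all _ fun p => ?_)
    rw [norm_norm]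
    exact (norm_inner_le_norm _ _).trans (mul_le_of_le_one_right (norm_nonneg _) (hG.norm_le _))
  simp_rw [inner_sub_left, real_inner_smul_left]
  rw [integral_sub (i1.const_mul _) (i2.const_mul _), integral_const_mul, integral_const_mul,
    integral_inner_compSum_mix lam c hG, integral_inner_snd_mix lam c hC hG]
  set D := meanJacobian lam c C G s κ with hD
  set R : ι → ℝ := fun k => κ * (∫ p, ⟪c k, G (mix lam c s κ p + s • c k)⟫ ∂(jointLaw lam C)
        - ∫ p, ⟪c k, G (mix lam c s κ p)⟫ ∂(jointLaw lam C) - s * ⟪c k, D (c k)⟫) with hR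
  have hRb : ∀ k, |R k| ≤ √(opNorm C⁻¹) * ‖c k‖ ^ 3 * s ^ 2 / 2 := fun k =>
    abs_taylor_remainder_le lam c hC hG hs κ (c k)
  have hquad : ∑ k, (lam k : ℝ) * ⟪c k, D (c k)⟫
      = ∑ i, ∑ j, compCov lam c i j * D (EuclideanSpace.single j 1) i := by
    have e : ∀ k, ⟪c k, D (c k)⟫
        = ∑ i, ∑ j, c k i * c k j * D (EuclideanSpace.single j 1) i := fun k => by
      have ec : D (c k) = ∑ j, c k j • D (EuclideanSpace.single j (1 : ℝ)) := by
        conv_lhs => rw [show c k = ∑ j, c k j • EuclideanSpace.single j (1 : ℝ) by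
          ext j; simp [Pi.single_apply]]
        simp
      rw [ec, PiLp.inner_apply]
      refine Finset.sum_congr rfl fun i _ => ?_
      simp [Finset.sum_mul]
      exact Finset.sum_congr rfl fun j _ => by ring
    simp_rw [e, compCov, Matrix.of_apply, Finset.mul_sum, Finset.sum_mul]
    rw [Finset.sum_comm]
    refine Finset.sum_congr rfl fun i _ => ?_
    rw [Finset.sum_comm]
    exact Finset.sum_congr rfl fun j _ => Finset.sum_congr rfl fun k _ => by ring
  have hsum : ∑ i, ∑ j, compCov lam c i j * D (EuclideanSpace.single j 1) i
      - ∑ i, ∑ j, C i j * D (EuclideanSpace.single j 1) i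
      = ∑ i, ∑ j, (compCov lam c - C) i j * D (EuclideanSpace.single j 1) i := by
    simp [sub_mul, Finset.sum_sub_distrib]
  have hmain : κ * ∑ k, (lam k : ℝ) * (∫ p, ⟪c k, G (mix lam c s κ p + s • c k)⟫ ∂(jointLaw lam C)
        - ∫ p, ⟪c k, G (mix lam c s κ p)⟫ ∂(jointLaw lam C))
      - s * (κ * ∑ i, ∑ j, C i j * D (EuclideanSpace.single j 1) i)
      = s * (κ * ∑ i, ∑ j, (compCov lam c - C) i j * D (EuclideanSpace.single j 1) i)
        + ∑ k, lam k * R k := by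
    have h : κ * ∑ k, (lam k : ℝ) * (∫ p, ⟪c k, G (mix lam c s κ p + s • c k)⟫ ∂(jointLaw lam C)
        - ∫ p, ⟪c k, G (mix lam c s κ p)⟫ ∂(jointLaw lam C))
        = s * (κ * ∑ k, (lam k : ℝ) * ⟪c k, D (c k)⟫) + ∑ k, lam k * R k := by
      rw [Finset.mul_sum, Finset.mul_sum, Finset.mul_sum, ← Finset.sum_add_distrib]
      exact Finset.sum_congr rfl fun k _ => by simp only [hR]; ring
    rw [h, ← hsum, ← hquad]
    ring
  rw [hmain]
  have h1 := abs_mul_sum_meanJacobian_le lam c hC hG s κ (compCov lam c - C)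
  rw [hsNorm_sub_comm] at h1
  have h2 : |∑ k, (lam k : ℝ) * R k| ≤ √(opNorm C⁻¹) * (1 / 2 * ∑ k, lam k * ‖c k‖ ^ 3) * s := by
    refine (Finset.abs_sum_le_sum_abs _ _).trans ?_
    rw [Finset.mul_sum, Finset.mul_sum, Finset.sum_mul]
    refine Finset.sum_le_sum fun k _ => ?_
    rw [abs_mul, abs_of_nonneg (lam k).coe_nonneg]
    -- one of the two factors `s` is given up: a bound proportional to `sin θ` integrates to `1`
    have hs2 : s ^ 2 ≤ s := by nlinarith
    calc (lam k : ℝ) * |R k| ≤ lam k * (√(opNorm C⁻¹) * ‖c k‖ ^ 3 * s / 2) := by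
          gcongr
          exact (hRb k).trans (by gcongr)
      _ = _ := by ring
  calc _ ≤ |s * (κ * ∑ i, ∑ j, (compCov lam c - C) i j * D (EuclideanSpace.single j 1) i)|
        + |∑ k, (lam k : ℝ) * R k| := abs_add_le _ _
    _ ≤ s * (√(opNorm C⁻¹) * hsNorm (C - compCov lam c))
        + √(opNorm C⁻¹) * (1 / 2 * ∑ k, lam k * ‖c k‖ ^ 3) * s := by
        rw [abs_mul, abs_of_nonneg hs]
        gcongr
    _ = _ := by ring

lemma isTestField_gradient {g : E → ℝ} (hg : g ∈ testFunctions d) : IsTestField (gradient g) where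
  contDiff := by
    have h1 : ContDiff ℝ 1 (fderiv ℝ g) := hg.1.fderiv_right (by norm_num)
    exact (InnerProductSpace.toDual ℝ E).symm.contDiff.comp h1
  norm_le x := by
    rw [gradient, LinearIsometryEquiv.norm_map]
    simpa using norm_fderiv_le_of_lipschitz ℝ hg.2.1 (x₀ := x)
  lipschitz := hg.2.2

/-- The derivative of the interpolation. The gradient of `g` is bounded, so `‖F‖ + ‖X‖`
dominates. -/
lemma hasDerivAt_integral_mix {g : E → ℝ} (hg : g ∈ testFunctions d) (θ : ℝ) :
    HasDerivAt (fun θ => ∫ p, g (mix lam c (Real.sin θ) (Real.cos θ) p) ∂(jointLaw lam C))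
      (∫ p, ⟪Real.cos θ • compSum lam c p.1 - Real.sin θ • p.2,
        gradient g (mix lam c (Real.sin θ) (Real.cos θ) p)⟫ ∂(jointLaw lam C)) θ := by
  have hG := isTestField_gradient hg
  have hFm := memLp_compSum_fst lam c C
  have hXm := memLp_snd lam C (d := d)
  refine (hasDerivAt_integral_of_dominated_loc_of_deriv_le
    (bound := fun p => ‖compSum lam c p.1‖ + ‖p.2‖)
    (F' := fun θ p => ⟪Real.cos θ • compSum lam c p.1 - Real.sin θ • p.2,
        gradient g (mix lam c (Real.sin θ) (Real.cos θ) p)⟫) (s := Set.univ) univ_mem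
    (Eventually.of_forall fun θ => (memLp_comp_mix lam c C _ _ hg.2.1).1)
    ((memLp_comp_mix lam c C _ _ hg.2.1).integrable one_le_two) ?_
    (ae_of_all _ fun p x _ => ?_) ?_ (ae_of_all _ fun p x _ => ?_)).2
  · have hv : Measurable fun p : (ι → ℕ) × E =>
        Real.cos θ • compSum lam c p.1 - Real.sin θ • p.2 := by
      convert measurable_mix lam c (Real.cos θ) (-Real.sin θ) using 2 with p
      simp only [mix, neg_smul, ← sub_eq_add_neg]
    exact (hv.inner (measurable_comp_mix lam c hG _ _)).aestronglyMeasurable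
  · refine (norm_inner_le_norm _ _).trans
      ((mul_le_of_le_one_right (norm_nonneg _) (hG.norm_le _)).trans ?_)
    refine (norm_sub_le _ _).trans ?_
    rw [norm_smul, norm_smul]
    gcongr
    · exact mul_le_of_le_one_left (norm_nonneg _) (Real.abs_cos_le_one x)
    · exact mul_le_of_le_one_left (norm_nonneg _) (Real.abs_sin_le_one x)
  · exact (hFm.integrable one_le_two).norm.add (hXm.integrable one_le_two).norm
  · have hl : HasDerivAt (fun θ : ℝ => mix lam c (Real.sin θ) (Real.cos θ) p)
        (Real.cos x • compSum lam c p.1 - Real.sin x • p.2) x := by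
      refine (((Real.hasDerivAt_sin x).smul_const (compSum lam c p.1)).add
        ((Real.hasDerivAt_cos x).smul_const p.2)).congr_deriv ?_
      module
    have h := (hg.1.differentiable two_ne_zero
      (mix lam c (Real.sin x) (Real.cos x) p)).hasGradientAt.hasFDerivAt.comp_hasDerivAt x hl
    rw [InnerProductSpace.toDual_apply_apply, real_inner_comm] at h
    exact h

/-- The Gaussian approximation of a compensated Poisson sum against a smooth test function. -/
lemma abs_integral_compSum_sub_gaussian_le (hC : C.PosDef) {g : E → ℝ} (hg : g ∈ testFunctions d) :
    |∫ n, g (compSum lam c n) ∂(poissonPi lam) - ∫ x, g x ∂(multivariateGaussian 0 C)|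
      ≤ √(opNorm C⁻¹) * (hsNorm (C - compCov lam c) + 1 / 2 * ∑ k, lam k * ‖c k‖ ^ 3) := by
  set M := √(opNorm C⁻¹) * (hsNorm (C - compCov lam c) + 1 / 2 * ∑ k, lam k * ‖c k‖ ^ 3) with hM
  set H : ℝ → ℝ := fun θ => ∫ p, g (mix lam c (Real.sin θ) (Real.cos θ) p) ∂(jointLaw lam C)
    with hH
  have hd := hasDerivAt_integral_mix lam c (C := C) hg
  -- `M * (1 - cos θ)` is the primitive of the speed bound `M * sin θ`, and equals `M` at `π / 2`
  have h := image_norm_le_of_norm_deriv_right_le_deriv_boundary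
    (f := fun θ => H θ - H 0) (a := 0) (b := Real.pi / 2)
    (B := fun θ => M * (1 - Real.cos θ)) (B' := fun θ => M * Real.sin θ)
    (fun θ _ => ((hd θ).sub_const _).continuousAt.continuousWithinAt)
    (fun θ _ => ((hd θ).sub_const _).hasDerivWithinAt) (by simp)
    (fun θ => (((Real.hasDerivAt_cos θ).const_sub 1).const_mul M).congr_deriv (by ring))
    (fun θ hθ => abs_integral_speed_le lam c hC (isTestField_gradient hg)
      (Real.sin_nonneg_of_nonneg_of_le_pi hθ.1 (by linarith [hθ.2, Real.pi_pos]))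
      (Real.sin_le_one θ)) (x := Real.pi / 2) ⟨by positivity, le_rfl⟩
  have h1 : H (Real.pi / 2) = ∫ n, g (compSum lam c n) ∂(poissonPi lam) := by
    simp only [hH, mix, Real.sin_pi_div_two, Real.cos_pi_div_two, one_smul, zero_smul, add_zero,
      jointLaw]
    rw [integral_fun_fst (f := fun n => g (compSum lam c n))]
    simp
  have h0 : H 0 = ∫ x, g x ∂(multivariateGaussian 0 C) := by
    simp only [hH, mix, Real.sin_zero, Real.cos_zero, one_smul, zero_smul, zero_add, jointLaw]
    rw [integral_fun_snd (f := fun x => g x)]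
    simp
  simpa [h1, h0] using h

end Remainder

/-! ### Integrals of simple functions against the compensated measure -/

section SimpleIntegral

variable {Ω Z : Type*} [MeasurableSpace Ω] [MeasurableSpace Z] {N : Ω → Measure Z} {μ : Measure Z}
  {P : Measure Ω} [IsProbabilityMeasure P]

omit [IsProbabilityMeasure P] in
lemma measurable_eval (hN : IsPoissonRandomMeasure N μ P) {B : Set Z} (hB : MeasurableSet B) :
    Measurable fun ω => N ω B :=
  (Measure.measurable_coe hB).comp hN.measurable

omit [IsProbabilityMeasure P] in
lemma ae_eval_lt_top (hN : IsPoissonRandomMeasure N μ P) {B : Set Z} (hB : MeasurableSet B)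
    (hμ : μ B < ∞) : ∀ᵐ ω ∂P, N ω B < ∞ := by
  rw [(hN.hasLaw B hB hμ).ae_iff (p := fun x => x < ∞)
    (measurableSet_setOfPred.1 measurableSet_Iio),
    ae_map_iff Measurable.of_discrete.aemeasurable measurableSet_Iio]
  exact ae_of_all _ fun n => ENNReal.natCast_lt_top n

omit [IsProbabilityMeasure P] in
lemma measurable_compensated (hN : IsPoissonRandomMeasure N μ P) {B : Set Z}
    (hB : MeasurableSet B) : Measurable (compensated N μ B) :=
  (measurable_eval hN hB).ennreal_toReal.sub_const _

/-- The masses of disjoint sets of finite measure are independent Poisson counts. -/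
lemma map_eval_eq (hN : IsPoissonRandomMeasure N μ P) {ι : Type*} [Fintype ι] {B : ι → Set Z}
    (hB : ∀ k, MeasurableSet (B k)) (hμ : ∀ k, μ (B k) < ∞)
    (hd : Pairwise fun k l => Disjoint (B k) (B l)) :
    P.map (fun ω k => N ω (B k))
      = (poissonPi fun k => (μ (B k)).toNNReal).map (fun n k => (n k : ℝ≥0∞)) := by
  have e := Fintype.equivFin ι
  have hind : iIndepFun (fun k ω => N ω (B k)) P := by
    have h := (hN.indep (Fintype.card ι) (fun i => B (e.symm i)) (fun i => hB _) (fun i => hμ _)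
      fun i j hij => hd (e.symm.injective.ne hij)).precomp e.injective
    simpa using h
  rw [(iIndepFun_iff_map_fun_eq_pi_map fun k => (measurable_eval hN (hB k)).aemeasurable).1 hind,
    poissonPi, Measure.pi_map_pi fun k => Measurable.of_discrete.aemeasurable]
  congr 1
  ext1 k
  rw [(hN.hasLaw (B k) (hB k) (hμ k)).map_eq]

variable {V : Type*} [NormedAddCommGroup V] [NormedSpace ℝ V] [SecondCountableTopology V]
  [CompleteSpace V] [MeasurableSpace V] [BorelSpace V]

omit [CompleteSpace V] in
lemma map_sum_compensated (hN : IsPoissonRandomMeasure N μ P) {ι : Type*} [Fintype ι]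
    {B : ι → Set Z} (hB : ∀ k, MeasurableSet (B k)) (hμ : ∀ k, μ (B k) < ∞)
    (hd : Pairwise fun k l => Disjoint (B k) (B l)) (c : ι → V) :
    P.map (fun ω => ∑ k, compensated N μ (B k) ω • c k)
      = (poissonPi fun k => (μ (B k)).toNNReal).map
          (compSum (fun k => (μ (B k)).toNNReal) c) := by
  have hf : Measurable fun w : ι → ℝ≥0∞ => ∑ k, ((w k).toReal - μ.real (B k)) • c k :=
    Finset.measurable_sum _ fun k _ =>
      ((measurable_pi_apply k).ennreal_toReal.sub_const _).smul_const _
  have h := congrArg (Measure.map fun w : ι → ℝ≥0∞ => ∑ k, ((w k).toReal - μ.real (B k)) • c k)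
    (map_eval_eq hN hB hμ hd)
  rw [Measure.map_map hf (measurable_pi_lambda _ fun k => measurable_eval hN (hB k)),
    Measure.map_map hf .of_discrete] at h
  convert h using 2
  · rfl
  · ext n
    simp only [Function.comp_apply, ENNReal.toReal_natCast, compSum, Measure.real]
    rfl

/-- The nonzero values of a simple function. -/
noncomputable def nonzeroValues (S : SimpleFunc Z V) : Finset V := by
  classical exact {x ∈ S.range | x ≠ 0}

omit [NormedSpace ℝ V] [SecondCountableTopology V] [CompleteSpace V] [MeasurableSpace V]
  [BorelSpace V] in
lemma ne_zero_of_nonzeroValues {S : SimpleFunc Z V} (x : nonzeroValues S) : (x : V) ≠ 0 := by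
  classical
  exact (Finset.mem_filter.1 x.2).2

/-- The intensities of the level sets of a simple function. -/
noncomputable def levelMass (μ : Measure Z) (S : SimpleFunc Z V) (x : nonzeroValues S) : ℝ≥0 :=
  (μ (S ⁻¹' {(x : V)})).toNNReal

/-- The integral `∑ x, N̂(S = x) x` of a vector-valued simple function, over the nonzero values
of `S`. -/
noncomputable def vectorIntegral (N : Ω → Measure Z) (μ : Measure Z) (S : SimpleFunc Z V) (ω : Ω) :
    V :=
  ∑ x : nonzeroValues S, compensated N μ (S ⁻¹' {(x : V)}) ω • (x : V)

omit [IsProbabilityMeasure P] [CompleteSpace V] in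
lemma measurable_vectorIntegral (hN : IsPoissonRandomMeasure N μ P) (S : SimpleFunc Z V) :
    Measurable (vectorIntegral N μ S) :=
  Finset.measurable_sum _ fun _ _ =>
    (measurable_compensated hN (S.measurableSet_fiber _)).smul_const _

omit [CompleteSpace V] in
/-- The integral of a simple function is distributed as a compensated sum of independent Poisson
counts, one for each nonzero value. -/
lemma map_vectorIntegral (hN : IsPoissonRandomMeasure N μ P) {S : SimpleFunc Z V}
    (hS : S.FinMeasSupp μ) :
    P.map (vectorIntegral N μ S)
      = (poissonPi (levelMass μ S)).map (compSum (levelMass μ S) fun x => (x : V)) :=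
  map_sum_compensated hN (fun x => S.measurableSet_fiber _)
    (fun x => hS.meas_preimage_singleton_ne_zero (ne_zero_of_nonzeroValues x))
    (fun x y hxy => by
      refine Set.disjoint_left.2 fun z hx hy => ?_
      exact hxy (Subtype.ext (hx.symm.trans hy))) _

omit [NormedSpace ℝ V] [SecondCountableTopology V] [CompleteSpace V] [MeasurableSpace V]
  [BorelSpace V] in
/-- The assumption `f 0 = 0` discards the level set of `0`, which may have infinite measure. -/
lemma integral_simpleFunc_eq_sum {S : SimpleFunc Z V} (hS : S.FinMeasSupp μ) {f : V → ℝ}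
    (hf : f 0 = 0) :
    ∫ z, f (S z) ∂μ = ∑ x : nonzeroValues S, (levelMass μ S x : ℝ) * f x := by
  classical
  have h1 := SimpleFunc.integral_eq_integral (S.map f) (hS.map hf).integrable
  rw [SimpleFunc.map_integral S f hS.integrable hf] at h1
  simp only [SimpleFunc.coe_map, Function.comp_apply] at h1
  rw [← h1, ← Finset.sum_filter_add_sum_filter_not S.range (fun x => x ≠ 0)]
  have h0 : ∑ x ∈ S.range with ¬ x ≠ 0, μ.real (S ⁻¹' {x}) • f x = 0 := by
    refine Finset.sum_eq_zero fun x hx => ?_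
    have : x = 0 := by simpa using (Finset.mem_filter.1 hx).2
    rw [this, hf, smul_zero]
  rw [h0, add_zero]
  rw [← Finset.sum_coe_sort (s := {x ∈ S.range | x ≠ 0}) (f := fun x => μ.real (S ⁻¹' {x}) • f x)]
  rfl

omit [IsProbabilityMeasure P] [NormedSpace ℝ V] [SecondCountableTopology V] [CompleteSpace V]
  [MeasurableSpace V] [BorelSpace V] in
lemma ae_finMeasSupp (hN : IsPoissonRandomMeasure N μ P) {S : SimpleFunc Z V}
    (hS : S.FinMeasSupp μ) : ∀ᵐ ω ∂P, S.FinMeasSupp (N ω) := by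
  have h : ∀ᵐ ω ∂P, N ω (S ⁻¹' {0}ᶜ) < ∞ := by
    refine ae_eval_lt_top hN (S.measurableSet_preimage _) ?_
    have := SimpleFunc.finMeasSupp_iff_support.1 hS
    exact this
  filter_upwards [h] with ω hω
  exact SimpleFunc.finMeasSupp_iff_support.2 hω

omit [MeasurableSpace Ω] in
lemma simpleIntegral_eq_integral_sub {s : SimpleFunc Z ℝ} (hs : s.FinMeasSupp μ) {ω : Ω}
    (hω : s.FinMeasSupp (N ω)) :
    simpleIntegral N μ s ω = ∫ z, s z ∂(N ω) - ∫ z, s z ∂μ := by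
  rw [← SimpleFunc.integral_eq_integral s hs.integrable,
    ← SimpleFunc.integral_eq_integral s hω.integrable, SimpleFunc.integral_eq,
    SimpleFunc.integral_eq, ← Finset.sum_sub_distrib]
  refine Finset.sum_congr rfl fun x _ => ?_
  simp only [compensated, smul_eq_mul]
  ring

omit [MeasurableSpace Ω] [SecondCountableTopology V] [MeasurableSpace V] [BorelSpace V] in
lemma vectorIntegral_eq_integral_sub {S : SimpleFunc Z V} (hS : S.FinMeasSupp μ) {ω : Ω}
    (hω : S.FinMeasSupp (N ω)) :
    vectorIntegral N μ S ω = ∫ z, S z ∂(N ω) - ∫ z, S z ∂μ := by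
  classical
  rw [← SimpleFunc.integral_eq_integral S hS.integrable,
    ← SimpleFunc.integral_eq_integral S hω.integrable, SimpleFunc.integral_eq_sum_filter,
    SimpleFunc.integral_eq_sum_filter, ← Finset.sum_sub_distrib]
  simp only [← sub_smul]
  rw [← Finset.sum_coe_sort]
  rfl

omit [IsProbabilityMeasure P] [SecondCountableTopology V] [MeasurableSpace V] [BorelSpace V] in
/-- Linear functionals commute with the integral of simple functions. This holds almost surely only:
the level sets of `f ∘ S` are unions of those of `S`, and the mass of a union splits in real numbers
only if it is finite. -/
lemma simpleIntegral_map_ae (hN : IsPoissonRandomMeasure N μ P) {S : SimpleFunc Z V}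
    (hS : S.FinMeasSupp μ) (f : V →L[ℝ] ℝ) :
    simpleIntegral N μ (S.map f) =ᵐ[P] fun ω => f (vectorIntegral N μ S ω) := by
  filter_upwards [ae_finMeasSupp hN hS] with ω hω
  rw [simpleIntegral_eq_integral_sub (hS.map (map_zero f)) (hω.map (map_zero f)),
    vectorIntegral_eq_integral_sub hS hω, map_sub, ← f.integral_comp_comm hS.integrable,
    ← f.integral_comp_comm hω.integrable]
  rfl

omit [IsProbabilityMeasure P] in
lemma simpleIntegral_sub_ae (hN : IsPoissonRandomMeasure N μ P) {s t : SimpleFunc Z ℝ}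
    (hs : s.FinMeasSupp μ) (ht : t.FinMeasSupp μ) :
    simpleIntegral N μ (s - t) =ᵐ[P]
      fun ω => simpleIntegral N μ s ω - simpleIntegral N μ t ω := by
  have hsub : ∀ ν : Measure Z, s.FinMeasSupp ν → t.FinMeasSupp ν → (s - t).FinMeasSupp ν :=
    fun ν h1 h2 => SimpleFunc.integrable_iff_finMeasSupp.1 (h1.integrable.sub h2.integrable)
  filter_upwards [ae_finMeasSupp hN hs, ae_finMeasSupp hN ht] with ω h1 h2
  rw [simpleIntegral_eq_integral_sub (hsub _ hs ht) (hsub _ h1 h2),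
    simpleIntegral_eq_integral_sub hs h1, simpleIntegral_eq_integral_sub ht h2]
  simp only [SimpleFunc.coe_sub, Pi.sub_apply]
  rw [integral_sub h1.integrable h2.integrable, integral_sub hs.integrable ht.integrable]
  ring

omit [CompleteSpace V] in
lemma memLp_vectorIntegral (hN : IsPoissonRandomMeasure N μ P) {S : SimpleFunc Z V}
    (hS : S.FinMeasSupp μ) : MemLp (vectorIntegral N μ S) 2 P := by
  classical
  have h := memLp_map_measure_iff (p := 2) (f := vectorIntegral N μ S) (μ := P) (g := (id : V → V))
    aestronglyMeasurable_id (measurable_vectorIntegral hN S).aemeasurable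
  rw [map_vectorIntegral hN hS, memLp_map_measure_iff aestronglyMeasurable_id
    Measurable.of_discrete.aemeasurable] at h
  exact h.1 (memLp_compSum _ _)

omit [CompleteSpace V] in
lemma integral_comp_vectorIntegral (hN : IsPoissonRandomMeasure N μ P) {S : SimpleFunc Z V}
    (hS : S.FinMeasSupp μ) {f : V → ℝ} (hf : Measurable f) :
    ∫ ω, f (vectorIntegral N μ S ω) ∂P
      = ∫ n, f (compSum (levelMass μ S) (fun x => (x : V)) n) ∂(poissonPi (levelMass μ S)) := by
  rw [← integral_map (measurable_vectorIntegral hN S).aemeasurable hf.aestronglyMeasurable,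
    map_vectorIntegral hN hS, integral_map Measurable.of_discrete.aemeasurable
      hf.aestronglyMeasurable]

omit [SecondCountableTopology V] [CompleteSpace V] [MeasurableSpace V] [BorelSpace V] in
lemma map_compSum {ι : Type*} [Fintype ι] (lam : ι → ℝ≥0) (c : ι → V) (f : V →L[ℝ] ℝ)
    (n : ι → ℕ) : f (compSum lam c n) = compSum lam (fun k => f (c k)) n := by
  simp [compSum]

omit [CompleteSpace V] in
/-- The isometry of the integral on simple functions. -/
lemma integral_vectorIntegral_mul (hN : IsPoissonRandomMeasure N μ P) {S : SimpleFunc Z V}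
    (hS : S.FinMeasSupp μ) (f g : V →L[ℝ] ℝ) :
    ∫ ω, f (vectorIntegral N μ S ω) * g (vectorIntegral N μ S ω) ∂P
      = ∫ z, f (S z) * g (S z) ∂μ := by
  classical
  rw [integral_comp_vectorIntegral hN hS (f := fun x => f x * g x)
    (f.measurable.mul g.measurable)]
  simp_rw [map_compSum]
  rw [integral_compSum_mul, integral_simpleFunc_eq_sum hS (f := fun x => f x * g x) (by simp)]

omit [CompleteSpace V] in
lemma integral_vectorIntegral (hN : IsPoissonRandomMeasure N μ P) {S : SimpleFunc Z V}
    (hS : S.FinMeasSupp μ) (f : V →L[ℝ] ℝ) :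
    ∫ ω, f (vectorIntegral N μ S ω) ∂P = 0 := by
  classical
  rw [integral_comp_vectorIntegral hN hS (f := f) f.measurable]
  simp_rw [map_compSum]
  rw [integral_compSum]

omit [IsProbabilityMeasure P] in
lemma simpleIntegral_ae (hN : IsPoissonRandomMeasure N μ P) {s : SimpleFunc Z ℝ}
    (hs : s.FinMeasSupp μ) : simpleIntegral N μ s =ᵐ[P] vectorIntegral N μ s :=
  simpleIntegral_map_ae hN hs (ContinuousLinearMap.id ℝ ℝ)

lemma memLp_simpleIntegral (hN : IsPoissonRandomMeasure N μ P) {s : SimpleFunc Z ℝ}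
    (hs : s.FinMeasSupp μ) : MemLp (simpleIntegral N μ s) 2 P :=
  (memLp_congr_ae (simpleIntegral_ae hN hs)).2 (memLp_vectorIntegral hN hs)

lemma eLpNorm_two_eq {α : Type*} [MeasurableSpace α] {ν : Measure α} {f : α → ℝ}
    (hf : MemLp f 2 ν) : eLpNorm f 2 ν = ENNReal.ofReal (√(∫ x, f x * f x ∂ν)) := by
  rw [hf.eLpNorm_eq_integral_rpow_norm two_ne_zero ENNReal.ofNat_ne_top]
  simp [Real.sqrt_eq_rpow, ← sq]

lemma eLpNorm_simpleIntegral (hN : IsPoissonRandomMeasure N μ P) {s : SimpleFunc Z ℝ}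
    (hs : s.FinMeasSupp μ) : eLpNorm (simpleIntegral N μ s) 2 P = eLpNorm s 2 μ := by
  have hm : MemLp s 2 μ :=
    (SimpleFunc.memLp_iff_finMeasSupp two_ne_zero ENNReal.ofNat_ne_top).2 hs
  rw [eLpNorm_congr_ae (simpleIntegral_ae hN hs), eLpNorm_two_eq (memLp_vectorIntegral hN hs),
    eLpNorm_two_eq hm]
  congr 2
  exact integral_vectorIntegral_mul hN hs (ContinuousLinearMap.id ℝ ℝ) (ContinuousLinearMap.id ℝ ℝ)

lemma eLpNorm_simpleIntegral_sub (hN : IsPoissonRandomMeasure N μ P) {s t : SimpleFunc Z ℝ}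
    (hs : s.FinMeasSupp μ) (ht : t.FinMeasSupp μ) :
    eLpNorm (simpleIntegral N μ s - simpleIntegral N μ t) 2 P = eLpNorm (⇑s - ⇑t) 2 μ := by
  have h : (s - t).FinMeasSupp μ :=
    SimpleFunc.integrable_iff_finMeasSupp.1 (hs.integrable.sub ht.integrable)
  have e : simpleIntegral N μ s - simpleIntegral N μ t =ᵐ[P] simpleIntegral N μ (s - t) :=
    (simpleIntegral_sub_ae hN hs ht).symm
  rw [eLpNorm_congr_ae e, eLpNorm_simpleIntegral hN h, SimpleFunc.coe_sub]

end SimpleIntegral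

/-! ### Existence and uniqueness of the Wiener-Itô integral -/

section WienerIto

variable {Ω Z : Type*} [MeasurableSpace Ω] [MeasurableSpace Z] {N : Ω → Measure Z} {μ : Measure Z}
  {P : Measure Ω} [IsProbabilityMeasure P]

/-- The integrals of simple functions converging to `h` are a Cauchy sequence in `L²(P)` by the
isometry. -/
lemma exists_isWienerIto (hN : IsPoissonRandomMeasure N μ P) {h : Z → ℝ} (hh : MemLp h 2 μ) :
    ∃ F, IsWienerIto N μ P h F := by
  -- with errors below `2⁻¹ ^ (k + 1)`, the terms beyond `K` are within the summable `2⁻¹ ^ K`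
  have hε : ∀ k : ℕ, ((2⁻¹ : ℝ≥0∞) ^ (k + 1)) ≠ 0 := fun k => by simp
  choose s hs hsm using fun k : ℕ =>
    hh.exists_simpleFunc_eLpNorm_sub_lt ENNReal.ofNat_ne_top (hε k)
  have hsf : ∀ k, (s k).FinMeasSupp μ := fun k =>
    (SimpleFunc.memLp_iff_finMeasSupp two_ne_zero ENNReal.ofNat_ne_top).1 (hsm k)
  have hs' : ∀ k, eLpNorm (⇑(s k) - h) 2 μ < (2⁻¹ : ℝ≥0∞) ^ (k + 1) := fun k => by
    rw [eLpNorm_sub_comm]; exact hs k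
  have hpow : ∀ {K k : ℕ}, K ≤ k → (2⁻¹ : ℝ≥0∞) ^ (k + 1) ≤ (2⁻¹ : ℝ≥0∞) ^ (K + 1) :=
    fun hKk => pow_le_pow_right_of_le_one' (by simp) (by omega)
  obtain ⟨F, hF, hlim⟩ := Lp.cauchy_complete_eLpNorm (p := 2) (μ := P) one_le_two
    (f := fun k => simpleIntegral N μ (s k)) (fun k => memLp_simpleIntegral hN (hsf k))
    (B := fun k => (2⁻¹ : ℝ≥0∞) ^ k) (by rw [ENNReal.tsum_geometric]; simp)
    (fun K n m hn hm => by
      rw [eLpNorm_simpleIntegral_sub hN (hsf n) (hsf m)]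
      have e : ⇑(s n) - ⇑(s m) = (⇑(s n) - h) + (h - ⇑(s m)) := by abel
      rw [e]
      refine (eLpNorm_add_le ((hsm n).sub hh).1 (hh.sub (hsm m)).1 one_le_two).trans_lt ?_
      calc _ < (2⁻¹ : ℝ≥0∞) ^ (n + 1) + (2⁻¹ : ℝ≥0∞) ^ (m + 1) :=
            ENNReal.add_lt_add (hs' n) (hs m)
        _ ≤ (2⁻¹ : ℝ≥0∞) ^ (K + 1) + (2⁻¹ : ℝ≥0∞) ^ (K + 1) := add_le_add (hpow hn) (hpow hm)
        _ = (2⁻¹ : ℝ≥0∞) ^ K := by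
            rw [pow_succ, ← mul_add, ENNReal.inv_two_add_inv_two, mul_one])
  refine ⟨F, hF, s, hsf, ?_, hlim⟩
  refine tendsto_of_tendsto_of_tendsto_of_le_of_le tendsto_const_nhds
    (h := fun k : ℕ => (2⁻¹ : ℝ≥0∞) ^ (k + 1)) ?_ (fun _ => zero_le) fun k => (hs' k).le
  exact (tendsto_add_atTop_iff_nat 1).2
    (ENNReal.tendsto_pow_atTop_nhds_zero_of_lt_one (by simp))

lemma isWienerIto_wienerIto (hN : IsPoissonRandomMeasure N μ P) {h : Z → ℝ} (hh : MemLp h 2 μ) :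
    IsWienerIto N μ P h (wienerIto N μ P h) := by
  have H := exists_isWienerIto hN hh
  rw [wienerIto, dif_pos H]
  exact H.choose_spec

/-- Any approximating sequence of simple functions computes the Wiener-Itô integral. -/
lemma IsWienerIto.tendsto (hN : IsPoissonRandomMeasure N μ P) {h : Z → ℝ} (hh : MemLp h 2 μ)
    {F : Ω → ℝ} (hF : IsWienerIto N μ P h F) {t : ℕ → SimpleFunc Z ℝ}
    (ht : ∀ k, (t k).FinMeasSupp μ)
    (hlim : Tendsto (fun k => eLpNorm (⇑(t k) - h) 2 μ) atTop (𝓝 0)) :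
    Tendsto (fun k => eLpNorm (simpleIntegral N μ (t k) - F) 2 P) atTop (𝓝 0) := by
  obtain ⟨hFm, s, hs, hsh, hsF⟩ := hF
  have hm : ∀ {u : SimpleFunc Z ℝ}, u.FinMeasSupp μ → MemLp u 2 μ := fun hu =>
    (SimpleFunc.memLp_iff_finMeasSupp two_ne_zero ENNReal.ofNat_ne_top).2 hu
  have hsum := (hlim.add hsh).add hsF
  simp only [add_zero] at hsum
  refine tendsto_of_tendsto_of_tendsto_of_le_of_le tendsto_const_nhds hsum (fun _ => zero_le)
    fun k => ?_
  have e : simpleIntegral N μ (t k) - F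
      = (simpleIntegral N μ (t k) - simpleIntegral N μ (s k)) + (simpleIntegral N μ (s k) - F) := by
    abel
  rw [e]
  refine (eLpNorm_add_le ((memLp_simpleIntegral hN (ht k)).sub (memLp_simpleIntegral hN (hs k))).1
    ((memLp_simpleIntegral hN (hs k)).sub hFm).1 one_le_two).trans ?_
  refine add_le_add ?_ le_rfl
  rw [eLpNorm_simpleIntegral_sub hN (ht k) (hs k)]
  have e2 : ⇑(t k) - ⇑(s k) = (⇑(t k) - h) + (h - ⇑(s k)) := by abel
  rw [e2]
  refine (eLpNorm_add_le ((hm (ht k)).sub hh).1 (hh.sub (hm (hs k))).1 one_le_two).trans ?_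
  rw [eLpNorm_sub_comm h]
  rfl

/-- Simple functions with support of finite measure approximate `f` simultaneously in all the `Lᵖ`
spaces, `p < ∞`, which contain it. -/
lemma exists_simpleFunc_tendsto {V : Type*} [NormedAddCommGroup V] [SecondCountableTopology V]
    [MeasurableSpace V] [BorelSpace V] {f : Z → V} (hf : MemLp f 2 μ) :
    ∃ S : ℕ → SimpleFunc Z V, (∀ k, (S k).FinMeasSupp μ) ∧ ∀ p : ℝ≥0∞, p ≠ ∞ → MemLp f p μ →
      Tendsto (fun k => eLpNorm (⇑(S k) - f) p μ) atTop (𝓝 0) := by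
  set f' := hf.1.mk f with hf'
  have hfm : Measurable f' := hf.1.stronglyMeasurable_mk.measurable
  have hae : f =ᵐ[μ] f' := hf.1.ae_eq_mk
  refine ⟨fun k => SimpleFunc.approxOn f' hfm (Set.range f' ∪ {0}) 0 (by simp) k, fun k => ?_,
    fun p hp hfp => ?_⟩
  · exact (SimpleFunc.memLp_iff_finMeasSupp two_ne_zero ENNReal.ofNat_ne_top).1
      (SimpleFunc.memLp_approxOn_range hfm ((memLp_congr_ae hae).1 hf) k)
  · have h := SimpleFunc.tendsto_approxOn_range_Lp_eLpNorm hp hfm ((memLp_congr_ae hae).1 hfp).2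
    refine h.congr fun k => eLpNorm_congr_ae ?_
    exact EventuallyEq.rfl.sub hae.symm

end WienerIto

/-! ### Passage to the limit along simple functions -/

lemma tendsto_toReal_eLpNorm {α V : Type*} [MeasurableSpace α] {ν : Measure α}
    [NormedAddCommGroup V] {p : ℝ≥0∞} [Fact (1 ≤ p)] {f : ℕ → α → V} {g : α → V}
    (hf : ∀ k, MemLp (f k) p ν) (hg : MemLp g p ν)
    (h : Tendsto (fun k => eLpNorm (f k - g) p ν) atTop (𝓝 0)) :
    Tendsto (fun k => (eLpNorm (f k) p ν).toReal) atTop (𝓝 (eLpNorm g p ν).toReal) := by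
  simpa only [Lp.norm_toLp] using ((Lp.tendsto_Lp_iff_tendsto_eLpNorm'' f hf g hg).2 h).norm

lemma tendsto_integral_mul {α : Type*} [MeasurableSpace α] {ν : Measure α}
    {f₁ f₂ : ℕ → α → ℝ} {g₁ g₂ : α → ℝ}
    (hf₁ : ∀ k, MemLp (f₁ k) 2 ν) (hf₂ : ∀ k, MemLp (f₂ k) 2 ν)
    (hg₁ : MemLp g₁ 2 ν) (hg₂ : MemLp g₂ 2 ν)
    (h₁ : Tendsto (fun k => eLpNorm (f₁ k - g₁) 2 ν) atTop (𝓝 0))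
    (h₂ : Tendsto (fun k => eLpNorm (f₂ k - g₂) 2 ν) atTop (𝓝 0)) :
    Tendsto (fun k => ∫ x, f₁ k x * f₂ k x ∂ν) atTop (𝓝 (∫ x, g₁ x * g₂ x ∂ν)) := by
  have e : ∀ {u v : α → ℝ} (hu : MemLp u 2 ν) (hv : MemLp v 2 ν),
      ⟪hv.toLp v, hu.toLp u⟫ = ∫ x, u x * v x ∂ν := fun {u v} hu hv => by
    rw [L2.inner_def]
    refine integral_congr_ae ?_
    filter_upwards [hu.coeFn_toLp, hv.coeFn_toLp] with x h1 h2
    rw [h1, h2]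
    simp
  have h := ((Lp.tendsto_Lp_iff_tendsto_eLpNorm'' f₂ hf₂ g₂ hg₂).2 h₂).inner (𝕜 := ℝ)
    ((Lp.tendsto_Lp_iff_tendsto_eLpNorm'' f₁ hf₁ g₁ hg₁).2 h₁)
  simpa only [e] using h

lemma toReal_eLpNorm_three_pow {α V : Type*} [MeasurableSpace α] {ν : Measure α}
    [NormedAddCommGroup V] {f : α → V} (hf : MemLp f 3 ν) :
    (eLpNorm f 3 ν).toReal ^ 3 = ∫ x, ‖f x‖ ^ 3 ∂ν := by
  rw [hf.eLpNorm_eq_integral_rpow_norm (by norm_num) (by norm_num),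
    ENNReal.toReal_ofReal (by positivity)]
  have h : 0 ≤ ∫ x, ‖f x‖ ^ (3 : ℝ≥0∞).toReal ∂ν := integral_nonneg fun x => by positivity
  rw [← Real.rpow_natCast, ← Real.rpow_mul h]
  norm_num

lemma eLpNorm_three_pow {α V : Type*} [MeasurableSpace α] {ν : Measure α}
    [NormedAddCommGroup V] (f : α → V) :
    eLpNorm f 3 ν ^ 3 = ∫⁻ x, ‖f x‖ₑ ^ 3 ∂ν := by
  rw [eLpNorm_eq_lintegral_rpow_enorm_toReal (by norm_num) (by norm_num), ← ENNReal.rpow_natCast,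
    ← ENNReal.rpow_mul]
  norm_num

lemma norm_le_sum_abs {d : ℕ} (v : EuclideanSpace ℝ (Fin d)) : ‖v‖ ≤ ∑ i, |v i| := by
  have h : v = ∑ i, v i • EuclideanSpace.single i (1 : ℝ) := by ext j; simp [Pi.single_apply]
  conv_lhs => rw [h]
  exact (norm_sum_le _ _).trans_eq (Finset.sum_congr rfl fun i _ => by simp [norm_smul])

/-- A power mean inequality: convexity of `x ↦ x^{3/2}` applied to the squared coordinates. -/
lemma norm_pow_three_le {d : ℕ} (v : EuclideanSpace ℝ (Fin d)) :
    ‖v‖ ^ 3 ≤ √d * ∑ i, |v i| ^ 3 := by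
  have h := Real.rpow_sum_le_const_mul_sum_rpow_of_nonneg (p := 3 / 2) Finset.univ
    (f := fun i => v i ^ 2) (by norm_num) fun i _ => sq_nonneg _
  have e : ∀ x : ℝ, (x ^ 2) ^ (3 / 2 : ℝ) = |x| ^ 3 := fun x => by
    rw [← sq_abs, ← Real.rpow_natCast, ← Real.rpow_mul (abs_nonneg _), ← Real.rpow_natCast]
    norm_num
  rw [← EuclideanSpace.real_norm_sq_eq, e, abs_norm] at h
  simp_rw [e] at h
  rw [Real.sqrt_eq_rpow]
  simpa [show (3 / 2 : ℝ) - 1 = 2⁻¹ by norm_num] using h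

section Limit

variable {Ω Z : Type*} [MeasurableSpace Ω] [MeasurableSpace Z] {N : Ω → Measure Z} {μ : Measure Z}
  {P : Measure Ω} [IsProbabilityMeasure P] {d : ℕ} {C : Matrix (Fin d) (Fin d) ℝ}

local notation "E" => EuclideanSpace ℝ (Fin d)

/-- The Gaussian approximation for the integral of a simple function. -/
lemma abs_integral_vectorIntegral_sub_le (hN : IsPoissonRandomMeasure N μ P) (hC : C.PosDef)
    {S : SimpleFunc Z E} (hS : S.FinMeasSupp μ) {g : E → ℝ} (hg : g ∈ testFunctions d) :
    |∫ ω, g (vectorIntegral N μ S ω) ∂P - ∫ x, g x ∂(multivariateGaussian 0 C)|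
      ≤ √(opNorm C⁻¹) * (hsNorm (C - Matrix.of fun i j => ∫ z, S z i * S z j ∂μ)
          + 1 / 2 * (eLpNorm S 3 μ).toReal ^ 3) := by
  classical
  have h := abs_integral_compSum_sub_gaussian_le (levelMass μ S) (fun x => (x : E)) hC hg
  rw [← integral_comp_vectorIntegral hN hS hg.1.continuous.measurable] at h
  have e1 : compCov (levelMass μ S) (fun x : nonzeroValues S => (x : E))
      = Matrix.of fun i j => ∫ z, S z i * S z j ∂μ := by
    ext i j
    rw [compCov, Matrix.of_apply, Matrix.of_apply,
      integral_simpleFunc_eq_sum hS (f := fun x : E => x i * x j) (by simp)]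
  have e2 : (eLpNorm S 3 μ).toReal ^ 3
      = ∑ x : nonzeroValues S, (levelMass μ S x : ℝ) * ‖(x : E)‖ ^ 3 := by
    rw [toReal_eLpNorm_three_pow
      ((SimpleFunc.memLp_iff_finMeasSupp (by norm_num) (by norm_num)).2 hS),
      integral_simpleFunc_eq_sum hS (f := fun x : E => ‖x‖ ^ 3) (by simp)]
  rwa [e1, ← e2] at h

/-- The vector `(h₁, …, h_d)` of kernels as a single function with values in `ℝᵈ`. -/
def kernelVector (h : Fin d → Z → ℝ) (z : Z) : E := WithLp.toLp 2 fun i => h i z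

lemma memLp_kernelVector {h : Fin d → Z → ℝ} {p : ℝ≥0∞} (hh : ∀ i, MemLp (h i) p μ) :
    MemLp (kernelVector h) p μ :=
  MemLp.of_eval_piLp hh

lemma tendsto_eLpNorm_eval {h : Fin d → Z → ℝ} {S : ℕ → SimpleFunc Z E} {p : ℝ≥0∞}
    (hS : Tendsto (fun k => eLpNorm (⇑(S k) - kernelVector h) p μ) atTop (𝓝 0)) (i : Fin d) :
    Tendsto (fun k => eLpNorm ((fun z => S k z i) - h i) p μ) atTop (𝓝 0) := by
  refine tendsto_of_tendsto_of_tendsto_of_le_of_le tendsto_const_nhds hS (fun _ => zero_le)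
    fun k => eLpNorm_mono fun z => ?_
  exact PiLp.norm_apply_le (S k z - kernelVector h z) i

/-- The integrals of vector-valued simple functions approximating the kernels converge, coordinate
by coordinate, to the vector of Wiener-Itô integrals. -/
lemma tendsto_vectorIntegral_eval (hN : IsPoissonRandomMeasure N μ P) {h : Fin d → Z → ℝ}
    (hh : ∀ i, MemLp (h i) 2 μ) {S : ℕ → SimpleFunc Z E} (hSf : ∀ k, (S k).FinMeasSupp μ)
    (hS : Tendsto (fun k => eLpNorm (⇑(S k) - kernelVector h) 2 μ) atTop (𝓝 0)) (i : Fin d) :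
    Tendsto (fun k => eLpNorm ((fun ω => vectorIntegral N μ (S k) ω i)
      - fun ω => chaosVector N μ P h ω i) 2 P) atTop (𝓝 0) := by
  have hF := isWienerIto_wienerIto hN (hh i)
  have := hF.tendsto hN (hh i) (t := fun k => (S k).map (EuclideanSpace.proj (𝕜 := ℝ) i))
    (fun k => (hSf k).map (map_zero _)) (tendsto_eLpNorm_eval hS i)
  refine this.congr fun k => eLpNorm_congr_ae ?_
  exact (simpleIntegral_map_ae hN (hSf k) (EuclideanSpace.proj i)).sub EventuallyEq.rfl

lemma memLp_chaosVector_eval (hN : IsPoissonRandomMeasure N μ P) {h : Fin d → Z → ℝ}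
    (hh : ∀ i, MemLp (h i) 2 μ) (i : Fin d) : MemLp (fun ω => chaosVector N μ P h ω i) 2 P :=
  (isWienerIto_wienerIto hN (hh i)).1

lemma memLp_chaosVector (hN : IsPoissonRandomMeasure N μ P) {h : Fin d → Z → ℝ}
    (hh : ∀ i, MemLp (h i) 2 μ) : MemLp (chaosVector N μ P h) 2 P :=
  MemLp.of_eval_piLp (memLp_chaosVector_eval hN hh)

lemma memLp_vectorIntegral_eval (hN : IsPoissonRandomMeasure N μ P) {S : SimpleFunc Z E}
    (hS : S.FinMeasSupp μ) (i : Fin d) : MemLp (fun ω => vectorIntegral N μ S ω i) 2 P :=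
  (memLp_vectorIntegral hN hS).eval_piLp i

lemma memLp_simpleFunc_eval {S : SimpleFunc Z E} (hS : S.FinMeasSupp μ) (i : Fin d) :
    MemLp (fun z => S z i) 2 μ :=
  ((SimpleFunc.memLp_iff_finMeasSupp two_ne_zero ENNReal.ofNat_ne_top).2 hS).eval_piLp i

/-- The Wiener-Itô isometry. -/
lemma integral_chaosVector_mul (hN : IsPoissonRandomMeasure N μ P) {h : Fin d → Z → ℝ}
    (hh : ∀ i, MemLp (h i) 2 μ) (i j : Fin d) :
    ∫ ω, chaosVector N μ P h ω i * chaosVector N μ P h ω j ∂P = ∫ z, h i z * h j z ∂μ := by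
  obtain ⟨S, hSf, hS⟩ := exists_simpleFunc_tendsto (memLp_kernelVector hh)
  have hS2 := hS 2 ENNReal.ofNat_ne_top (memLp_kernelVector hh)
  have h1 := tendsto_integral_mul (fun k => memLp_vectorIntegral_eval hN (hSf k) i)
    (fun k => memLp_vectorIntegral_eval hN (hSf k) j) (memLp_chaosVector_eval hN hh i)
    (memLp_chaosVector_eval hN hh j) (tendsto_vectorIntegral_eval hN hh hSf hS2 i)
    (tendsto_vectorIntegral_eval hN hh hSf hS2 j)
  have h2 := tendsto_integral_mul (fun k => memLp_simpleFunc_eval (hSf k) i)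
    (fun k => memLp_simpleFunc_eval (hSf k) j) (hh i) (hh j) (tendsto_eLpNorm_eval hS2 i)
    (tendsto_eLpNorm_eval hS2 j)
  refine tendsto_nhds_unique h1 (h2.congr fun k => ?_)
  exact (integral_vectorIntegral_mul hN (hSf k) (EuclideanSpace.proj i)
    (EuclideanSpace.proj j)).symm

lemma integral_chaosVector (hN : IsPoissonRandomMeasure N μ P) {h : Fin d → Z → ℝ}
    (hh : ∀ i, MemLp (h i) 2 μ) (i : Fin d) : ∫ ω, chaosVector N μ P h ω i ∂P = 0 := by
  obtain ⟨S, hSf, hS⟩ := exists_simpleFunc_tendsto (memLp_kernelVector hh)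
  have hS2 := hS 2 ENNReal.ofNat_ne_top (memLp_kernelVector hh)
  have h1 := tendsto_integral_mul (f₂ := fun _ _ => 1) (g₂ := fun _ => 1)
    (fun k => memLp_vectorIntegral_eval hN (hSf k) i) (fun k => memLp_const _)
    (memLp_chaosVector_eval hN hh i) (memLp_const _) (tendsto_vectorIntegral_eval hN hh hSf hS2 i)
    (by simp)
  simp only [mul_one] at h1
  refine tendsto_nhds_unique h1 (tendsto_const_nhds.congr fun k => ?_)
  exact (integral_vectorIntegral hN (hSf k) (EuclideanSpace.proj i)).symm

lemma covMatrix_chaosVector (hN : IsPoissonRandomMeasure N μ P) {h : Fin d → Z → ℝ}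
    (hh : ∀ i, MemLp (h i) 2 μ) :
    covMatrix (chaosVector N μ P h) P = Matrix.of fun i j => ∫ z, h i z * h j z ∂μ := by
  ext i j
  rw [covMatrix, Matrix.of_apply, Matrix.of_apply,
    covariance_eq_sub (memLp_chaosVector_eval hN hh i) (memLp_chaosVector_eval hN hh j),
    integral_chaosVector hN hh i, zero_mul, sub_zero]
  exact integral_chaosVector_mul hN hh i j

lemma tendsto_integral_comp_vectorIntegral (hN : IsPoissonRandomMeasure N μ P) {h : Fin d → Z → ℝ}
    (hh : ∀ i, MemLp (h i) 2 μ) {S : ℕ → SimpleFunc Z E} (hSf : ∀ k, (S k).FinMeasSupp μ)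
    (hS : Tendsto (fun k => eLpNorm (⇑(S k) - kernelVector h) 2 μ) atTop (𝓝 0))
    {g : E → ℝ} (hg : LipschitzWith 1 g) :
    Tendsto (fun k => ∫ ω, g (vectorIntegral N μ (S k) ω) ∂P) atTop
      (𝓝 (∫ ω, g (chaosVector N μ P h ω) ∂P)) := by
  have hgm : ∀ {Y : Ω → E}, MemLp Y 2 P → MemLp (fun ω => g (Y ω)) 2 P :=
    fun hY => memLp_lipschitz_comp hg hY
  have hF := memLp_chaosVector hN hh
  refine tendsto_integral_of_L1' _ (hgm hF).1
    (Eventually.of_forall fun k => (hgm (memLp_vectorIntegral hN (hSf k))).integrable one_le_two) ?_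
  have hsum : Tendsto (fun k => ∑ i, eLpNorm ((fun ω => vectorIntegral N μ (S k) ω i)
      - fun ω => chaosVector N μ P h ω i) 2 P) atTop (𝓝 0) := by
    simpa using tendsto_finsetSum Finset.univ
      fun i _ => tendsto_vectorIntegral_eval hN hh hSf hS i
  refine tendsto_of_tendsto_of_tendsto_of_le_of_le tendsto_const_nhds hsum (fun _ => zero_le)
    fun k => ?_
  have hm : ∀ i, MemLp (fun ω => vectorIntegral N μ (S k) ω i - chaosVector N μ P h ω i) 2 P :=
    fun i => (memLp_vectorIntegral_eval hN (hSf k) i).sub (memLp_chaosVector_eval hN hh i)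
  calc eLpNorm ((fun ω => g (vectorIntegral N μ (S k) ω)) - fun ω => g (chaosVector N μ P h ω)) 1 P
      ≤ eLpNorm ((fun ω => g (vectorIntegral N μ (S k) ω)) - fun ω => g (chaosVector N μ P h ω))
          2 P := eLpNorm_le_eLpNorm_of_exponent_le one_le_two
            ((hgm (memLp_vectorIntegral hN (hSf k))).sub (hgm hF)).1
    _ ≤ eLpNorm (∑ i, fun ω => |vectorIntegral N μ (S k) ω i - chaosVector N μ P h ω i|) 2 P := by
        refine eLpNorm_mono fun ω => ?_
        rw [Finset.sum_apply, Real.norm_of_nonneg (Finset.sum_nonneg fun i _ => abs_nonneg _)]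
        refine le_trans ?_ (norm_le_sum_abs (vectorIntegral N μ (S k) ω - chaosVector N μ P h ω))
        simpa [dist_eq_norm] using hg.dist_le_mul (vectorIntegral N μ (S k) ω)
          (chaosVector N μ P h ω)
    _ ≤ ∑ i, eLpNorm (fun ω => |vectorIntegral N μ (S k) ω i - chaosVector N μ P h ω i|) 2 P :=
        eLpNorm_sum_le (fun i _ => (hm i).abs.1) one_le_two
    _ = _ := by
        refine Finset.sum_congr rfl fun i _ => ?_
        exact eLpNorm_norm fun ω => vectorIntegral N μ (S k) ω i - chaosVector N μ P h ω i

lemma continuous_hsNorm : Continuous (hsNorm : Matrix (Fin d) (Fin d) ℝ → ℝ) := by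
  have h : (hsNorm : Matrix (Fin d) (Fin d) ℝ → ℝ) = fun A => √(∑ i, ∑ j, A i j ^ 2) :=
    funext hsNorm_eq
  rw [h]
  fun_prop

/-- The Gaussian approximation of a vector of Wiener-Itô integrals, tested against one function. -/
lemma abs_integral_chaosVector_sub_le (hN : IsPoissonRandomMeasure N μ P) (hC : C.PosDef)
    {h : Fin d → Z → ℝ} (hh : ∀ i, MemLp (h i) 2 μ) (hh3 : MemLp (kernelVector h) 3 μ)
    {g : E → ℝ} (hg : g ∈ testFunctions d) :
    |∫ ω, g (chaosVector N μ P h ω) ∂P - ∫ x, g x ∂(multivariateGaussian 0 C)|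
      ≤ √(opNorm C⁻¹) * (hsNorm (C - covMatrix (chaosVector N μ P h) P)
          + 1 / 2 * (eLpNorm (kernelVector h) 3 μ).toReal ^ 3) := by
  obtain ⟨S, hSf, hS⟩ := exists_simpleFunc_tendsto (memLp_kernelVector hh)
  have hS2 := hS 2 ENNReal.ofNat_ne_top (memLp_kernelVector hh)
  have hS3 := hS 3 ENNReal.ofNat_ne_top hh3
  have : Fact ((1 : ℝ≥0∞) ≤ 3) := ⟨by norm_num⟩
  have hl := ((tendsto_integral_comp_vectorIntegral hN hh hSf hS2 hg.2.1).sub_const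
    (∫ x, g x ∂(multivariateGaussian 0 C))).abs
  have hK : Tendsto (fun k => Matrix.of fun i j => ∫ z, S k z i * S k z j ∂μ) atTop
      (𝓝 (covMatrix (chaosVector N μ P h) P)) := by
    rw [covMatrix_chaosVector hN hh]
    refine tendsto_pi_nhds.2 fun i => tendsto_pi_nhds.2 fun j => ?_
    exact tendsto_integral_mul (fun k => memLp_simpleFunc_eval (hSf k) i)
      (fun k => memLp_simpleFunc_eval (hSf k) j) (hh i) (hh j) (tendsto_eLpNorm_eval hS2 i)
      (tendsto_eLpNorm_eval hS2 j)
  have h3 := tendsto_toReal_eLpNorm (fun k =>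
    (SimpleFunc.memLp_iff_finMeasSupp (by norm_num) (by norm_num)).2 (hSf k)) hh3 hS3
  have hr := (((continuous_hsNorm.tendsto _).comp (hK.const_sub C)).add
    ((h3.pow 3).const_mul (1 / 2))).const_mul √(opNorm C⁻¹)
  exact le_of_tendsto_of_tendsto' hl hr fun k =>
    abs_integral_vectorIntegral_sub_le hN hC (hSf k) hg

end Limit

/-! ### The distance `d₂` and convergence in distribution -/

section Distance

variable {d : ℕ}

local notation "E" => EuclideanSpace ℝ (Fin d)

lemma one_le_opNorm_inv_mul (hd : 0 < d) {C : Matrix (Fin d) (Fin d) ℝ} (hC : C.PosDef) :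
    1 ≤ opNorm C⁻¹ * opNorm C := by
  have : Nonempty (Fin d) := ⟨⟨0, hd⟩⟩
  have h : Matrix.toEuclideanCLM (n := Fin d) (𝕜 := ℝ) C⁻¹ * Matrix.toEuclideanCLM (𝕜 := ℝ) C
      = 1 := by
    rw [← map_mul, Matrix.nonsing_inv_mul _ ((Matrix.isUnit_iff_isUnit_det _).1 hC.isUnit), map_one]
  have h2 := norm_mul_le (Matrix.toEuclideanCLM (n := Fin d) (𝕜 := ℝ) C⁻¹)
    (Matrix.toEuclideanCLM (𝕜 := ℝ) C)
  rw [h, norm_one] at h2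
  exact h2

lemma opNorm_inv_pos (hd : 0 < d) {C : Matrix (Fin d) (Fin d) ℝ} (hC : C.PosDef) :
    0 < opNorm C⁻¹ := by
  have h := one_le_opNorm_inv_mul hd hC
  by_contra hn
  have h0 : opNorm C⁻¹ = 0 := le_antisymm (not_lt.1 hn) (opNorm_nonneg _)
  rw [h0, zero_mul] at h
  linarith

/-- Linear waves with bounded second derivatives are multiples of test functions. -/
lemma mul_comp_inner_mem_testFunctions {φ φ' : ℝ → ℝ} (hφ : ContDiff ℝ 2 φ)
    (hd : ∀ x, HasDerivAt φ (φ' x) x) (hl : LipschitzWith 1 φ) (hl' : LipschitzWith 1 φ') (t : E) :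
    (fun x => (1 + ‖t‖ ^ 2)⁻¹ * φ ⟪x, t⟫) ∈ testFunctions d := by
  -- the first and second derivatives grow like `‖t‖` and `‖t‖ ^ 2`, both at most `1 + ‖t‖ ^ 2`
  set r : ℝ := (1 + ‖t‖ ^ 2)⁻¹ with hr
  have hr0 : 0 ≤ r := by positivity
  have hr1 : r * ‖t‖ ≤ 1 := by
    rw [hr, inv_mul_le_iff₀ (by positivity)]
    nlinarith [sq_nonneg (‖t‖ - 1)]
  have hr2 : r * ‖t‖ ^ 2 ≤ 1 := by
    rw [hr, inv_mul_le_iff₀ (by positivity)]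
    linarith
  have hgrad : gradient (fun x : E => r * φ ⟪x, t⟫) = fun x => (r * φ' ⟪x, t⟫) • t := by
    ext1 x
    refine HasGradientAt.gradient ?_
    have h1 : HasFDerivAt (fun x : E => ⟪x, t⟫) (innerSL ℝ t) x := by
      refine (innerSL ℝ t).hasFDerivAt.congr_of_eventuallyEq (Eventually.of_forall fun y => ?_)
      simp [real_inner_comm]
    have h2 := ((hd ⟪x, t⟫).comp_hasFDerivAt x h1).const_mul r
    rw [hasGradientAt_iff_hasFDerivAt]
    refine h2.congr_fderiv ?_
    ext y
    simp [mul_assoc]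
  have hin : ∀ x y : E, |⟪x, t⟫ - ⟪y, t⟫| ≤ ‖x - y‖ * ‖t‖ := fun x y => by
    rw [← inner_sub_left]; exact abs_real_inner_le_norm _ _
  refine ⟨contDiff_const.mul (hφ.comp (contDiff_id.inner ℝ contDiff_const)),
    LipschitzWith.of_dist_le_mul fun x y => ?_, ?_⟩
  · have h := hl.dist_le_mul ⟪x, t⟫ ⟪y, t⟫
    simp only [NNReal.coe_one, one_mul, Real.dist_eq] at h ⊢
    rw [← mul_sub, abs_mul, abs_of_nonneg hr0, dist_eq_norm]
    calc r * |φ ⟪x, t⟫ - φ ⟪y, t⟫| ≤ r * (‖x - y‖ * ‖t‖) := by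
          gcongr; exact h.trans (hin x y)
      _ = (r * ‖t‖) * ‖x - y‖ := by ring
      _ ≤ ‖x - y‖ := mul_le_of_le_one_left (norm_nonneg _) hr1
  · rw [hgrad]
    refine LipschitzWith.of_dist_le_mul fun x y => ?_
    have h := hl'.dist_le_mul ⟪x, t⟫ ⟪y, t⟫
    simp only [NNReal.coe_one, one_mul, Real.dist_eq] at h ⊢
    rw [dist_eq_norm, dist_eq_norm, ← sub_smul, ← mul_sub, norm_smul, norm_mul, Real.norm_eq_abs,
      Real.norm_eq_abs, abs_of_nonneg hr0]
    calc r * |φ' ⟪x, t⟫ - φ' ⟪y, t⟫| * ‖t‖ ≤ r * (‖x - y‖ * ‖t‖) * ‖t‖ := by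
          gcongr; exact h.trans (hin x y)
      _ = (r * ‖t‖ ^ 2) * ‖x - y‖ := by ring
      _ ≤ ‖x - y‖ := mul_le_of_le_one_left (norm_nonneg _) hr2

lemma cos_inner_mem_testFunctions (t : E) :
    (fun x => (1 + ‖t‖ ^ 2)⁻¹ * Real.cos ⟪x, t⟫) ∈ testFunctions d :=
  mul_comp_inner_mem_testFunctions (φ' := fun x => -Real.sin x) Real.contDiff_cos
    Real.hasDerivAt_cos Real.lipschitzWith_cos Real.lipschitzWith_sin.neg t

lemma sin_inner_mem_testFunctions (t : E) :
    (fun x => (1 + ‖t‖ ^ 2)⁻¹ * Real.sin ⟪x, t⟫) ∈ testFunctions d :=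
  mul_comp_inner_mem_testFunctions Real.contDiff_sin
    Real.hasDerivAt_sin Real.lipschitzWith_sin Real.lipschitzWith_cos t

lemma tendsto_integral_of_tendsto_d2 {ν : ℕ → Measure E} {ν₀ : Measure E}
    (h : Tendsto (fun n => d2 (ν n) ν₀) atTop (𝓝 0)) {g : E → ℝ} (hg : g ∈ testFunctions d) :
    Tendsto (fun n => ∫ x, g x ∂(ν n)) atTop (𝓝 (∫ x, g x ∂ν₀)) := by
  have h1 : Tendsto (fun n => ENNReal.ofReal |∫ x, g x ∂(ν n) - ∫ x, g x ∂ν₀|) atTop (𝓝 0) :=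
    tendsto_of_tendsto_of_tendsto_of_le_of_le tendsto_const_nhds h (fun _ => zero_le)
      fun n => le_iSup₂_of_le g hg le_rfl
  have h2 := (ENNReal.tendsto_toReal ENNReal.zero_ne_top).comp h1
  simp only [Function.comp_def, ENNReal.toReal_ofReal (abs_nonneg _), ENNReal.toReal_zero] at h2
  rw [tendsto_iff_dist_tendsto_zero]
  simpa only [Real.dist_eq] using h2

lemma charFun_eq_integral_cos_sin (ν : Measure E) [IsProbabilityMeasure ν] (t : E) :
    charFun ν t = ((∫ x, Real.cos ⟪x, t⟫ ∂ν : ℝ) : ℂ)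
      + ((∫ x, Real.sin ⟪x, t⟫ ∂ν : ℝ) : ℂ) * Complex.I := by
  have hc : Integrable (fun x : E => ((Real.cos ⟪x, t⟫ : ℝ) : ℂ)) ν :=
    (Integrable.of_bound
      (by fun_prop : Measurable fun x : E => Real.cos ⟪x, t⟫).aestronglyMeasurable 1
      (ae_of_all _ fun x => Real.abs_cos_le_one _)).ofReal
  have hs : Integrable (fun x : E => ((Real.sin ⟪x, t⟫ : ℝ) : ℂ)) ν :=
    (Integrable.of_bound
      (by fun_prop : Measurable fun x : E => Real.sin ⟪x, t⟫).aestronglyMeasurable 1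
      (ae_of_all _ fun x => Real.abs_sin_le_one _)).ofReal
  rw [charFun_apply, ← integral_complex_ofReal, ← integral_complex_ofReal, ← integral_mul_const,
    ← integral_add hc (hs.mul_const _)]
  refine integral_congr_ae (ae_of_all _ fun x => ?_)
  simp only [Complex.exp_mul_I, Complex.ofReal_cos, Complex.ofReal_sin]

/-- The distance `d₂` controls weak convergence, because it controls characteristic functions. -/
lemma tendsto_of_tendsto_d2 {ν : ℕ → ProbabilityMeasure E} {ν₀ : ProbabilityMeasure E}
    (h : Tendsto (fun n => d2 (ν n : Measure E) (ν₀ : Measure E)) atTop (𝓝 0)) :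
    Tendsto ν atTop (𝓝 ν₀) := by
  refine ProbabilityMeasure.tendsto_iff_tendsto_charFun.2 fun t => ?_
  have hr : (1 + ‖t‖ ^ 2) ≠ 0 := by positivity
  have key : ∀ {φ : ℝ → ℝ}, (fun x : E => (1 + ‖t‖ ^ 2)⁻¹ * φ ⟪x, t⟫) ∈ testFunctions d →
      Tendsto (fun n => ∫ x, φ ⟪x, t⟫ ∂(ν n : Measure E)) atTop
        (𝓝 (∫ x, φ ⟪x, t⟫ ∂(ν₀ : Measure E))) := fun {φ} hφ => by
    have h1 := (tendsto_integral_of_tendsto_d2 h hφ).const_mul (1 + ‖t‖ ^ 2)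
    simp_rw [integral_const_mul, mul_inv_cancel_left₀ hr] at h1
    exact h1
  simp_rw [charFun_eq_integral_cos_sin]
  exact ((Complex.continuous_ofReal.tendsto _).comp (key (cos_inner_mem_testFunctions t))).add
    (((Complex.continuous_ofReal.tendsto _).comp (key (sin_inner_mem_testFunctions t))).mul_const _)

end Distance

/-! ### The quantitative bound -/

section Main

variable {Ω Z : Type*} [MeasurableSpace Ω] [MeasurableSpace Z] {N : Ω → Measure Z} {μ : Measure Z}
  {P : Measure Ω} [IsProbabilityMeasure P] {d : ℕ} {C : Matrix (Fin d) (Fin d) ℝ}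

/-- The constant of the third-order term. -/
lemma half_mul_sqrt_mul_sqrt_le (hd : 2 ≤ d) (hC : C.PosDef) :
    √(opNorm C⁻¹) * (1 / 2) * √d
      ≤ (d : ℝ) ^ 2 * √(2 * Real.pi) / 8 * opNorm C⁻¹ ^ (3 / 2 : ℝ) * opNorm C := by
  have hpos := opNorm_inv_pos (by omega) hC
  have h1 := one_le_opNorm_inv_mul (by omega) hC
  have hdr : (2 : ℝ) ≤ d := by exact_mod_cast hd
  have hpi : (5 / 2 : ℝ) ≤ √(2 * Real.pi) :=
    Real.le_sqrt_of_sq_le (by nlinarith [Real.pi_gt_d2])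
  have hsd : √(d : ℝ) ≤ d := by
    rw [Real.sqrt_le_left (by linarith)]
    nlinarith
  have hrp : opNorm C⁻¹ ^ (3 / 2 : ℝ) = √(opNorm C⁻¹) * opNorm C⁻¹ := by
    rw [show (3 / 2 : ℝ) = 1 / 2 + 1 by norm_num, Real.rpow_add hpos, Real.rpow_one,
      Real.sqrt_eq_rpow]
  rw [hrp]
  have h2 : 1 / 2 * √(d : ℝ) ≤ (d : ℝ) ^ 2 * √(2 * Real.pi) / 8 := by
    have : (d : ℝ) ^ 2 * (5 / 2) ≤ (d : ℝ) ^ 2 * √(2 * Real.pi) := by gcongr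
    nlinarith
  have h3 : 0 ≤ √(opNorm C⁻¹) := Real.sqrt_nonneg _
  calc √(opNorm C⁻¹) * (1 / 2) * √d = √(opNorm C⁻¹) * (1 / 2 * √d) * 1 := by ring
    _ ≤ √(opNorm C⁻¹) * ((d : ℝ) ^ 2 * √(2 * Real.pi) / 8) * (opNorm C⁻¹ * opNorm C) := by
        gcongr
    _ = _ := by ring

/-- The constant of the covariance term. -/
lemma sqrt_opNorm_inv_le (hd : 0 < d) (hC : C.PosDef) :
    √(opNorm C⁻¹) ≤ opNorm C⁻¹ * opNorm C ^ (1 / 2 : ℝ) := by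
  rw [← Real.sqrt_eq_rpow]
  refine Real.sqrt_le_iff.2 ⟨mul_nonneg (opNorm_nonneg _) (Real.sqrt_nonneg _), ?_⟩
  rw [mul_pow, Real.sq_sqrt (opNorm_nonneg _)]
  nlinarith [one_le_opNorm_inv_mul hd hC, opNorm_nonneg C⁻¹]

lemma lintegral_kernelVector_le {h : Fin d → Z → ℝ} (hh : ∀ i, MemLp (h i) 2 μ) :
    ∫⁻ z, ‖kernelVector h z‖ₑ ^ 3 ∂μ
      ≤ ENNReal.ofReal √d * ∑ i, ∫⁻ z, ‖h i z‖ₑ ^ 3 ∂μ := by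
  rw [← lintegral_finsetSum' _ fun i _ => (hh i).1.enorm.pow_const 3,
    ← lintegral_const_mul' _ _ ENNReal.ofReal_ne_top]
  refine lintegral_mono fun z => ?_
  have h1 := ENNReal.ofReal_le_ofReal (norm_pow_three_le (kernelVector h z))
  rw [ENNReal.ofReal_mul (Real.sqrt_nonneg _), ENNReal.ofReal_pow (norm_nonneg _),
    ofReal_norm, ENNReal.ofReal_sum_of_nonneg fun i _ => by positivity] at h1
  refine h1.trans_eq ?_
  congr 1
  refine Finset.sum_congr rfl fun i _ => ?_
  rw [ENNReal.ofReal_pow (abs_nonneg _), ← Real.norm_eq_abs, ofReal_norm]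
  rfl

/-- The quantitative bound. When some kernel is not in `L³` the right-hand side is infinite. -/
lemma d2_chaosVector_le (hN : IsPoissonRandomMeasure N μ P) (hd : 2 ≤ d) (hC : C.PosDef)
    {h : Fin d → Z → ℝ} (hh : ∀ i, MemLp (h i) 2 μ) :
    d2 (P.map (chaosVector N μ P h)) (multivariateGaussian 0 C) ≤
      ENNReal.ofReal (opNorm C⁻¹ * opNorm C ^ (1 / 2 : ℝ)
        * hsNorm (C - covMatrix (chaosVector N μ P h) P))
      + ENNReal.ofReal ((d : ℝ) ^ 2 * √(2 * Real.pi) / 8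
          * opNorm C⁻¹ ^ (3 / 2 : ℝ) * opNorm C) * ∑ i, ∫⁻ z, ‖h i z‖ₑ ^ 3 ∂μ := by
  have hconst := half_mul_sqrt_mul_sqrt_le hd hC
  have hpos := opNorm_inv_pos (by omega) hC
  have hd0 : (0 : ℝ) < d := by exact_mod_cast (by omega : 0 < d)
  set c₃ := (d : ℝ) ^ 2 * √(2 * Real.pi) / 8 * opNorm C⁻¹ ^ (3 / 2 : ℝ) * opNorm C with hc₃
  have hc₃pos : 0 < c₃ := lt_of_lt_of_le (by positivity) hconst
  -- the constant is positive, so an infinite sum of cubes makes the bound trivial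
  by_cases htop : ∑ i, ∫⁻ z, ‖h i z‖ₑ ^ 3 ∂μ = ∞
  · rw [htop, ENNReal.mul_top (by simpa using hc₃pos), add_top]
    exact le_top
  have hlt : eLpNorm (kernelVector h) 3 μ ^ 3 ≠ ∞ := by
    rw [eLpNorm_three_pow]
    exact ne_top_of_le_ne_top (ENNReal.mul_ne_top ENNReal.ofReal_ne_top htop)
      (lintegral_kernelVector_le hh)
  have hlt' : eLpNorm (kernelVector h) 3 μ ≠ ∞ := fun h0 => hlt (by simp [h0])
  have hh3 : MemLp (kernelVector h) 3 μ := ⟨(memLp_kernelVector hh).1, hlt'.lt_top⟩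
  refine iSup₂_le fun g hg => ?_
  have hgc : Continuous g := hg.1.continuous
  rw [integral_map (memLp_chaosVector hN hh).1.aemeasurable hgc.aestronglyMeasurable]
  refine (ENNReal.ofReal_le_ofReal (abs_integral_chaosVector_sub_le hN hC hh hh3 hg)).trans ?_
  have hhs : 0 ≤ hsNorm (C - covMatrix (chaosVector N μ P h) P) := Real.sqrt_nonneg _
  rw [mul_add, ENNReal.ofReal_add (by positivity) (by positivity)]
  refine add_le_add (ENNReal.ofReal_le_ofReal ?_) ?_
  · gcongr
    exact sqrt_opNorm_inv_le (by omega) hC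
  · rw [← mul_assoc, ENNReal.ofReal_mul (by positivity), ENNReal.ofReal_pow ENNReal.toReal_nonneg,
      ENNReal.ofReal_toReal hlt', eLpNorm_three_pow]
    calc _ ≤ ENNReal.ofReal (√(opNorm C⁻¹) * (1 / 2))
          * (ENNReal.ofReal √d * ∑ i, ∫⁻ z, ‖h i z‖ₑ ^ 3 ∂μ) := by
          gcongr
          exact lintegral_kernelVector_le hh
      _ = ENNReal.ofReal (√(opNorm C⁻¹) * (1 / 2) * √d) * ∑ i, ∫⁻ z, ‖h i z‖ₑ ^ 3 ∂μ := by
          rw [← mul_assoc, ← ENNReal.ofReal_mul (by positivity)]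
      _ ≤ _ := by gcongr

end Main

end PoissonChaos

theorem corollary3p4
    {Z : Type*} [MeasurableSpace Z] (μ : Measure Z) [SigmaFinite μ]
    {Ω : Type*} [MeasurableSpace Ω] (P : Measure Ω) [IsProbabilityMeasure P]
    (N : Ω → Measure Z) (hN : PoissonChaos.IsPoissonRandomMeasure N μ P)
    (d : ℕ) (hd : 2 ≤ d)
    (C : Matrix (Fin d) (Fin d) ℝ) (hC : C.PosDef)
    {Ω' : Type*} [MeasurableSpace Ω'] (P' : Measure Ω') [IsProbabilityMeasure P']
    (X : Ω' → EuclideanSpace ℝ (Fin d)) (hX : HasLaw X (multivariateGaussian 0 C) P')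
    (h : ℕ → Fin d → Z → ℝ) (hh : ∀ n i, MemLp (h n i) 2 μ)
    (F : ℕ → Ω → EuclideanSpace ℝ (Fin d))
    (hF : ∀ n, F n = PoissonChaos.chaosVector N μ P (h n))
    (K : ℕ → Matrix (Fin d) (Fin d) ℝ) (hK : ∀ n, K n = PoissonChaos.covMatrix (F n) P) :
    (∀ n i j, K n i j = ∫ ω, F n ω i * F n ω j ∂P ∧ K n i j = ∫ z, h n i z * h n j z ∂μ) ∧
    (∀ n, PoissonChaos.d2 (P.map (F n)) (P'.map X) ≤
      ENNReal.ofReal (PoissonChaos.opNorm C⁻¹ * PoissonChaos.opNorm C ^ (1 / 2 : ℝ)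
        * PoissonChaos.hsNorm (C - K n))
      + ENNReal.ofReal ((d : ℝ) ^ 2 * √(2 * Real.pi) / 8
          * PoissonChaos.opNorm C⁻¹ ^ (3 / 2 : ℝ) * PoissonChaos.opNorm C)
        * ∑ i, ∫⁻ z, ‖h n i z‖ₑ ^ 3 ∂μ) ∧
    ((∀ i j, Tendsto (fun n => K n i j) atTop (𝓝 (C i j))) →
      (∀ i, Tendsto (fun n => ∫⁻ z, ‖h n i z‖ₑ ^ 3 ∂μ) atTop (𝓝 0)) →
      Tendsto (fun n => PoissonChaos.d2 (P.map (F n)) (P'.map X)) atTop (𝓝 0) ∧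
        TendstoInDistribution F atTop X (fun _ => P) P') := by
  have hbound : ∀ n, PoissonChaos.d2 (P.map (F n)) (P'.map X) ≤
      ENNReal.ofReal (PoissonChaos.opNorm C⁻¹ * PoissonChaos.opNorm C ^ (1 / 2 : ℝ)
        * PoissonChaos.hsNorm (C - K n))
      + ENNReal.ofReal ((d : ℝ) ^ 2 * √(2 * Real.pi) / 8
          * PoissonChaos.opNorm C⁻¹ ^ (3 / 2 : ℝ) * PoissonChaos.opNorm C)
        * ∑ i, ∫⁻ z, ‖h n i z‖ₑ ^ 3 ∂μ := fun n => by
    rw [hK n, hF n, hX.map_eq]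
    exact PoissonChaos.d2_chaosVector_le hN hd hC (hh n)
  refine ⟨fun n i j => ?_, hbound, fun hKC h3 => ?_⟩
  · have e : K n i j = ∫ z, h n i z * h n j z ∂μ := by
      rw [hK n, hF n, PoissonChaos.covMatrix_chaosVector hN (hh n), Matrix.of_apply]
    refine ⟨?_, e⟩
    rw [e, hF n, PoissonChaos.integral_chaosVector_mul hN (hh n)]
  · have hd2 : Tendsto (fun n => PoissonChaos.d2 (P.map (F n)) (P'.map X)) atTop (𝓝 0) := by
      refine tendsto_of_tendsto_of_tendsto_of_le_of_le tendsto_const_nhds ?_ (fun _ => zero_le)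
        hbound
      have hKl : Tendsto K atTop (𝓝 C) :=
        tendsto_pi_nhds.2 fun i => tendsto_pi_nhds.2 fun j => hKC i j
      have h1 := ENNReal.tendsto_ofReal ((((PoissonChaos.continuous_hsNorm.tendsto _).comp
        (hKl.const_sub C))).const_mul
          (PoissonChaos.opNorm C⁻¹ * PoissonChaos.opNorm C ^ (1 / 2 : ℝ)))
      have h2 := ENNReal.Tendsto.const_mul (tendsto_finsetSum Finset.univ fun i _ => h3 i)
        (Or.inr (ENNReal.ofReal_ne_top (r := (d : ℝ) ^ 2 * √(2 * Real.pi) / 8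
          * PoissonChaos.opNorm C⁻¹ ^ (3 / 2 : ℝ) * PoissonChaos.opNorm C)))
      have hz : PoissonChaos.hsNorm (0 : Matrix (Fin d) (Fin d) ℝ) = 0 := by
        simp [PoissonChaos.hsNorm]
      simpa [hz] using h1.add h2
    refine ⟨hd2, ⟨fun n => ?_, hX.aemeasurable, PoissonChaos.tendsto_of_tendsto_d2 hd2⟩⟩
    rw [hF n]
    exact (PoissonChaos.memLp_chaosVector hN (hh n)).1.aemeasurable
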